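/- **LSE convergence rate.** *Market.* Let $\alpha\in[0,1]$, $r_o^b\in\mathbb R$, $c\in(0,1]$, $\mu\in\mathbb R$, $\sigma>0$, $\zeta>0$ and $\eta_b>0$ be constant. The collateral price is a geometric Brownian motion $p_{t+1}=p_t\exp(\mu+\sigma z_t)$, $z_t\sim\mathcal N(0,1)$ i.i.d., $p_0>0$. Every unit of debt is backed by $\frac1{c\,p_t}$ units of collateral (loan-to-value ratio $c$), and expected liquidations are zero. At interest rate $r$ and price $p=p_t$, with expected default $\pi=\mathbb E[\max\{0,1-\tfrac{p_{t+1}}{c\,p}\}]$ of a unit of debt, the two types of borrowers have utilities $$u^{1}=r_o^b-r+\pi+\tfrac1{c\,p}\,\mathbb E\big[\mathbf 1_{p_{t+1}<p}\,(p_{t+1}-p)\big],\qquad u^{2}=-r+\pi+\mathbb E\big[\tfrac{p_{t+1}-p}{p}\big],$$ expectations being over $p_{t+1}$ given $p_t=p$. The total debt $B_t$ (with $B_0>0$) evolves by $$\frac{B_{t+1}-B_t}{B_t}=\eta_b\big(\alpha u^1+(1-\alpha)u^2\big)+\varepsilon_t,\qquad \varepsilon_t\sim\mathcal N(0,\zeta^2)\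 \text{i.i.d., independent of }(z_t).$$ With $X=p_{t+1}/p_t$, the equilibrium interest rate, at which the expected change of the debt vanishes, is $$r^*=\alpha r_o^b+\mathbb E\big[\max\{0,1-\tfrac Xc\}\big]+\tfrac{\alpha}{c}\,\mathbb E\big[\mathbf 1_{X<1}(X-1)\big]+(1-\alpha)\,\mathbb E[X-1],$$ so that $\frac{B_{t+1}-B_t}{B_t}=\eta_b(r^*-r_t)+\varepsilon_t$. *Controller.* Fix an exploration probability $\nu\in(0,1]$ and $r_{\min}<r_{\max}$. At time $0$ an arbitrary rate $r_0\in\mathbb R$ is in force (for instance the equilibrium rate of the market before its parameters changed), and the controller, once activated, collects samples $(r_s,\Delta B_s)$, $\Delta B_s=\frac{B_{s+1}-B_s}{B_s}$, in consecutive slots $s=0,1,2,\dots$ without resets. From the first $n$ samples it computes the least-squares coefficients $\hat\Theta=(P^\top P)^{-1}P^\top\Delta B$, where $P$ has the rows $[1,r_s]$, $s<n$, and the estimate $\hat r_n=-\hat\Theta(0)/\hat\Theta(1)$; while this is undefined ($P^\top P$ singular or $\hat\Theta(1)=0$), $\hat r_n$ is the current rate $r_{n-1}$. Then, independently of everything else,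 it sets $r_n=\hat r_n$ with probability $1-\nu$, and with probability $\nu$ it draws $r_n$ uniformly from $[r_{\min},r_{\max}]$. The controller that stops after $\tau$ samples outputs $r_\tau:=\hat r_\tau$ (without exploration). *Claim 1.* The rate of equilibrium convergence is $O\big(\log(1/\delta)/\sqrt\tau\big)$: there is a constant $C>0$, depending only on the market parameters above and on $\nu,r_{\min},r_{\max}$, such that for all $r_0\in\mathbb R$, $p_0>0$, $B_0>0$ and all $\delta\in(0,1)$ there is a $T(\delta)$ with $$\mathbb P\Big(|r_\tau-r^*|<C\,\frac{\log(1/\delta)}{\sqrt\tau}\Big)\ \ge\ 1-\delta\qquad\text{for every }\tau>T(\delta).$$ *Claim 2.* Suppose $\eta_b$ is known, so that the controller fits by least squares only the unknown intercept $\theta=\eta_b r^*$ of $\Delta B_s=\theta-\eta_b r_s+\varepsilon_s$ and uses $\hat r_n=\hat\theta_n/\eta_b$, $\hat\theta_n=\frac1n\sum_{s<n}(\Delta B_s+\eta_b r_s)$, in place of the estimate above (exploration and output as before). Then for all $r_0\in\mathbb R$, $p_0>0$, $B_0>0$ and every $\tau\ge1$, $r_\tau$ is integrable and $\mathbb E[r_\tau]=r^*$.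 -/

import Mathlib

open MeasureTheory ProbabilityTheory

noncomputable section

namespace LendingPool

/-- Parameters of the market during a period in which it is stable. -/
structure Market where
  /-- fraction of financing borrowers; the others are leveraged traders -/
  α : ℝ
  /-- external (risk-free) borrow rate -/
  rExt : ℝ
  /-- collateral factor: the loan-to-value ratio kept by the borrowers -/
  c : ℝ
  /-- drift of the collateral price -/
  μ : ℝ
  /-- volatility of the collateral price -/
  σ : ℝ
  /-- elasticity of the borrowers -/
  η : ℝ
  /-- standard deviation of the noise in the borrowers' behaviour -/
  ζ : NNReal
  α_nonneg : 0 ≤ α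
  α_le_one : α ≤ 1
  c_pos : 0 < c
  c_le_one : c ≤ 1
  σ_pos : 0 < σ
  ζ_pos : 0 < ζ

namespace Market

variable (m : Market)

/-- One step of the geometric Brownian price: the price after `p` under the standard normal
innovation `z`. -/
def nextPrice (p z : ℝ) : ℝ := p * Real.exp (m.μ + m.σ * z)

/-- Expectation of `f p'` over the next price `p'`, given that the current price is `p`. -/
def priceExp (p : ℝ) (f : ℝ → ℝ) : ℝ := ∫ z, f (m.nextPrice p z) ∂(gaussianReal 0 1)

/-- Collateral posted at price `p` for one unit of debt at loan-to-value ratio `c`. -/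
def collateral (p : ℝ) : ℝ := 1 / (m.c * p)

/-- Expected default of one unit of debt over the next slot. -/
def expectedDefault (p : ℝ) : ℝ := m.priceExp p fun q => max 0 (1 - m.collateral p * q)

/-- Utility of a financing borrower with one unit of debt at price `p` and interest rate `r`
(the expected liquidation at the posted collateral factor is zero). -/
def utilityFinancing (p r : ℝ) : ℝ :=
  m.rExt - r + m.expectedDefault p
    + m.collateral p * m.priceExp p fun q => if q - p < 0 then q - p else 0

/-- Utility of a leveraged trading borrower with one unit of debt at price `p` and interest
rate `r` (the expected liquidation at the posted collateral factor is zero). -/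
def utilityLeveraged (p r : ℝ) : ℝ :=
  -r + m.expectedDefault p + m.priceExp p fun q => (q - p) / p

/-- Expected relative change of the debt over one slot: elasticity times average utility. -/
def drift (p r : ℝ) : ℝ :=
  m.η * (m.α * m.utilityFinancing p r + (1 - m.α) * m.utilityLeveraged p r)

/-- The equilibrium interest rate `r*`, in terms of the price ratio `X = p_{t+1} / p_t`, which is
the next price after price `1`. -/
def equilibriumRate : ℝ :=
  m.α * m.rExt
    + m.priceExp 1 (fun X => max 0 (1 - X / m.c))
    + m.α / m.c * m.priceExp 1 (fun X => if X < 1 then X - 1 else 0)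
    + (1 - m.α) * m.priceExp 1 (fun X => X - 1)

/-- The expected relative change of the debt is `η (r* - r)`; so for `η > 0` the debt is in
equilibrium exactly at the rate `r*`. -/
theorem drift_eq (p r : ℝ) (hp : 0 < p) : m.drift p r = m.η * (m.equilibriumRate - r) := by
  have hc : m.c ≠ 0 := m.c_pos.ne'
  have hp' : p ≠ 0 := hp.ne'
  have h1 : m.expectedDefault p = m.priceExp 1 (fun X => max 0 (1 - X / m.c)) := by
    unfold expectedDefault priceExp collateral nextPrice
    congr 1; ext z; field_simp
  have h2 : m.priceExp p (fun q => (q - p) / p) = m.priceExp 1 (fun X => X - 1) := by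
    unfold priceExp nextPrice
    congr 1; ext z; field_simp
  have h3 : m.priceExp p (fun q => if q - p < 0 then q - p else 0)
      = p * m.priceExp 1 (fun X => if X < 1 then X - 1 else 0) := by
    unfold priceExp nextPrice
    rw [← integral_const_mul]
    congr 1; ext z
    have : p * Real.exp (m.μ + m.σ * z) - p < 0 ↔ 1 * Real.exp (m.μ + m.σ * z) < 1 := by
      rw [sub_neg, one_mul]; exact mul_lt_iff_lt_one_right hp
    simp only [this]
    split_ifs <;> ring
  unfold drift utilityFinancing utilityLeveraged equilibriumRate
  rw [h1, h2, h3, collateral]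
  field_simp
  ring

end Market

/-- Exploration parameters of the interest rate controller. -/
structure Controller where
  /-- exploration probability -/
  ν : unitInterval
  /-- least exploratory rate -/
  rMin : ℝ
  /-- largest exploratory rate -/
  rMax : ℝ
  ν_pos : 0 < ν
  rMin_lt_rMax : rMin < rMax

/-- The randomness of one time slot `(z, ε, b, w)`: price innovation `z`, noise `ε` in the
borrowers' behaviour, exploration coin `b`, exploratory rate `w`. -/
abbrev Slot : Type := ℝ × ℝ × Bool × ℝ

/-- The uniform law of the exploratory rate. -/
def explorationLaw (K : Controller) : Measure ℝ := (volume : Measure ℝ)[|Set.Icc K.rMin K.rMax]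

instance (K : Controller) : IsProbabilityMeasure (explorationLaw K) := by
  refine cond_isProbabilityMeasure_of_finite ?_ ?_ <;> simp [K.rMin_lt_rMax]

/-- Law of the randomness of one slot: the four components are independent. -/
def slotLaw (m : Market) (K : Controller) : Measure Slot :=
  (gaussianReal 0 1).prod ((gaussianReal 0 (m.ζ ^ 2)).prod
    ((bernoulliMeasure true false K.ν).prod (explorationLaw K)))

instance (m : Market) (K : Controller) : IsProbabilityMeasure (slotLaw m K) := by
  unfold slotLaw; infer_instance

/-- Joint law of the randomness of all slots, which are independent and identically distributed. -/
def poolLaw (m : Market) (K : Controller) : Measure (ℕ → Slot) :=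
  Measure.infinitePi fun _ => slotLaw m K

/-- An estimator of the equilibrium rate: `est n r y` is the estimate from the `n` samples
`(r 0, y 0), …, (r (n - 1), y (n - 1))` of an interest rate and the relative change of the debt
that it caused. -/
abbrev Estimator : Type := ℕ → (ℕ → ℝ) → (ℕ → ℝ) → ℝ

/-- The matrix with rows `[1, r i]`, `i < n`. -/
def designMatrix (n : ℕ) (r : ℕ → ℝ) : Matrix (Fin n) (Fin 2) ℝ := Matrix.of fun i => ![1, r i]

/-- Ordinary least squares `(Pᵀ P)⁻¹ Pᵀ ΔB`. -/
def lsCoeff (n : ℕ) (r y : ℕ → ℝ) : Fin 2 → ℝ :=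
  ((designMatrix n r).transpose * designMatrix n r)⁻¹.mulVec
    ((designMatrix n r).transpose.mulVec fun i : Fin n => y i)

open scoped Classical in
/-- Least-squares estimate `-Θ̂(0) / Θ̂(1)` of the equilibrium rate. While it does not exist (the
rates seen so far do not determine `Θ̂`, or `Θ̂(1) = 0`), the current rate is kept. -/
def lsEstimator : Estimator := fun n r y =>
  if IsUnit ((designMatrix n r).transpose * designMatrix n r).det ∧ lsCoeff n r y 1 ≠ 0 then
    -lsCoeff n r y 0 / lsCoeff n r y 1
  else r (n - 1)

/-- Least-squares estimate of the equilibrium rate when the slope `-η` is known: the intercept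
`θ = η r*` is the only unknown, the least-squares solution of `y i = θ - η r i` is the mean of
`y i + η r i`, and the estimate of `r*` is that mean divided by `η`. -/
def knownElasticityEstimator (η : ℝ) : Estimator := fun n r y =>
  (∑ i ∈ Finset.range n, (y i + η * r i)) / n / η

/-- The pool at the beginning of slot `t`. The rates `rate 0, …, rate t` have been set and the
relative debt changes `growth 0, …, growth (t - 1)` have been observed (other entries are unused). -/
structure State where
  /-- price of the collateral asset -/
  price : ℝ
  /-- total debt of the borrowers -/
  debt : ℝ
  /-- interest rates set so far -/
  rate : ℕ → ℝ
  /-- relative changes of the debt observed so far -/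
  growth : ℕ → ℝ

/-- The debt at the end of a slot with interest rate `r` and noise `ε`. -/
def nextDebt (m : Market) (p B r ε : ℝ) : ℝ := B + B * (m.drift p r + ε)

/-- Slot `t`: the borrowers react to `rate t`, the controller adds the sample and sets the next
rate to the new estimate or, if the coin says so, to the exploratory rate. -/
def step (m : Market) (est : Estimator) (t : ℕ) (s : State) (x : Slot) : State :=
  let debt' := nextDebt m s.price s.debt (s.rate t) x.2.1
  let growth' := Function.update s.growth t ((debt' - s.debt) / s.debt)
  { price := m.nextPrice s.price x.1
    debt := debt'
    rate := Function.update s.rate (t + 1)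
      (if x.2.2.1 then x.2.2.2 else est (t + 1) s.rate growth')
    growth := growth' }

/-- The pool under the controller, which starts collecting samples at time `0` with price `p₀`,
debt `B₀` and interest rate `r₀`. -/
def trajectory (m : Market) (est : Estimator) (r₀ p₀ B₀ : ℝ) (ω : ℕ → Slot) : ℕ → State
  | 0 => ⟨p₀, B₀, fun _ => r₀, fun _ => 0⟩
  | t + 1 => step m est t (trajectory m est r₀ p₀ B₀ ω t) (ω t)

/-- The rate `r_τ` set by the controller that stops after `τ` samples: its last estimate. -/
def stoppedRate (m : Market) (est : Estimator) (r₀ p₀ B₀ : ℝ) (τ : ℕ) (ω : ℕ → Slot) : ℝ :=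
  est τ (trajectory m est r₀ p₀ B₀ ω τ).rate (trajectory m est r₀ p₀ B₀ ω τ).growth

/-- `f δ τ` bounds the distance of `r_τ` from the equilibrium rate with probability at least
`1 - δ`, for all `τ` beyond a threshold `T(δ)`. -/
def IsConvergenceBound (m : Market) (K : Controller) (est : Estimator) (r₀ p₀ B₀ : ℝ)
    (f : ℝ → ℕ → ℝ) : Prop :=
  ∀ δ : ℝ, 0 < δ → δ < 1 → ∃ T : ℕ, ∀ τ : ℕ, T < τ →
    1 - δ ≤ (poolLaw m K).real
      {ω | |stoppedRate m est r₀ p₀ B₀ τ ω - m.equilibriumRate| < f δ τ}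

end LendingPool

end

/-
Almost surely the debt changes by `η (r* - r_s) + ε_s`, so with `x_s = r_s - r*` least squares
estimates the zero of `x ↦ -η x`, and its error `e_n` is a function of the empirical moments of `x`
and `ε`. The exploratory rates alone keep the empirical variance of `x` above `c (1 + mean(x) ^ 2)`
with `c > 0`, whatever the estimates do. An exponential supermartingale bounds `|mean(x ε)|` by
`κ (1 + mean(x ^ 2))` for every `κ > 0`, eventually; hence the regression coefficient of `ε` on `x`
vanishes, `e_n` is first bounded and then, as exploitation sets `x_n = e_n`, tends to `0`. The
moments of `x` therefore converge to the limits `a`, `q` that exploration alone produces, and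
`√n e_n` differs by a null sequence from `√n mean((q - a x) ε) / (η (q - a ^ 2))`. The exploited
rates contribute nothing to this limit by the same supermartingale, so `x_s` may be replaced by
its explored part, which is independent of `ε_s`, and the central limit theorem for i.i.d. terms
applies. A centred Gaussian of variance `v` has absolute value less than `10 √v L` with probability
greater than `1 - exp (-L)`; take `L = log (1 / δ)`.

When `η` is known, the estimate is `r* + mean(ε) / η`.
-/

open Filter Topology
open scoped NNReal ENNReal

noncomputable section

/-- The mean of the first `n` terms of a real sequence; it is `0` for `n = 0`. -/
def empMean (n : ℕ) : (ℕ → ℝ) →ₗ[ℝ] ℝ :=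
  (n : ℝ)⁻¹ • ∑ s ∈ Finset.range n, LinearMap.proj s

/-- The covariance of the first `n` terms of two real sequences. -/
def empCov (n : ℕ) (f g : ℕ → ℝ) : ℝ :=
  empMean n (f * g) - empMean n f * empMean n g

section EmpiricalMoments

variable {f g : ℕ → ℝ} {n : ℕ}

lemma empMean_apply (n : ℕ) (f : ℕ → ℝ) :
    empMean n f = (n : ℝ)⁻¹ * ∑ s ∈ Finset.range n, f s := by
  simp [empMean]

lemma empMean_const (hn : n ≠ 0) (c : ℝ) : empMean n (fun _ => c) = c := by
  simp [empMean_apply, hn]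

lemma empMean_congr (h : ∀ s < n, f s = g s) : empMean n f = empMean n g := by
  simp only [empMean_apply]
  rw [Finset.sum_congr rfl fun s hs => h s (Finset.mem_range.1 hs)]

lemma empMean_mono (h : f ≤ g) : empMean n f ≤ empMean n g := by
  simp only [empMean_apply]
  gcongr with s
  exact h s

lemma empCov_congr {f' g' : ℕ → ℝ} (hf : ∀ s < n, f s = f' s) (hg : ∀ s < n, g s = g' s) :
    empCov n f g = empCov n f' g' := by
  have hfg : empMean n (f * g) = empMean n (f' * g') :=
    empMean_congr fun s hs => congrArg₂ (· * ·) (hf s hs) (hg s hs)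
  rw [empCov, empCov, empMean_congr hf, empMean_congr hg, hfg]

lemma measurable_empMean (n : ℕ) : Measurable (empMean n) := by
  simp only [funext (empMean_apply n)]
  fun_prop

lemma measurable_empCov (n : ℕ) : Measurable fun p : (ℕ → ℝ) × (ℕ → ℝ) => empCov n p.1 p.2 :=
  ((measurable_empMean n).comp (measurable_fst.mul measurable_snd)).sub
    (((measurable_empMean n).comp measurable_fst).mul ((measurable_empMean n).comp measurable_snd))

lemma abs_empMean_le {B : ℝ} (h : ∀ s, |f s| ≤ B) : |empMean n f| ≤ B := by
  have hB : 0 ≤ B := (abs_nonneg _).trans (h 0)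
  rcases eq_or_ne n 0 with rfl | hn
  · simpa [empMean_apply] using hB
  · rw [abs_le]
    constructor
    · rw [← empMean_const hn (-B)]
      exact empMean_mono fun s => neg_le_of_abs_le (h s)
    · rw [← empMean_const hn B]
      exact empMean_mono fun s => le_of_abs_le (h s)

lemma tendsto_empMean {l : ℝ} (h : Tendsto f atTop (𝓝 l)) :
    Tendsto (fun n => empMean n f) atTop (𝓝 l) := by
  simpa only [empMean_apply] using h.cesaro

lemma empMean_sub_mean_mul (f g : ℕ → ℝ) (t : ℝ) :
    empMean n (fun s => (f s - t) * g s) = empMean n (f * g) - t * empMean n g := by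
  rw [← smul_eq_mul t, ← map_smul, ← map_sub]
  congr 1
  ext s
  simp [sub_mul]

lemma empMean_mul_sub_sq (β f : ℕ → ℝ) (t : ℝ) :
    empMean n (fun s => β s * (f s - t) ^ 2)
      = empMean n (β * f ^ 2) - 2 * t * empMean n (β * f) + t ^ 2 * empMean n β := by
  rw [← smul_eq_mul (2 * t), ← smul_eq_mul (t ^ 2), ← map_smul, ← map_smul, ← map_sub, ← map_add]
  congr 1
  ext s
  simp only [Pi.add_apply, Pi.sub_apply, Pi.smul_apply, Pi.mul_apply, Pi.pow_apply, smul_eq_mul]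
  ring

lemma empMean_affine_mul (n : ℕ) (f g : ℕ → ℝ) (b c : ℝ) :
    empMean n (fun s => (b * f s + c) * g s) = b * empMean n (f * g) + c * empMean n g := by
  rw [← smul_eq_mul b, ← smul_eq_mul c, ← map_smul, ← map_smul, ← map_add]
  congr 1
  ext s
  simp [add_mul, mul_assoc]

lemma empCov_comm (n : ℕ) (f g : ℕ → ℝ) : empCov n f g = empCov n g f := by
  rw [empCov, empCov, mul_comm f, mul_comm (empMean n f)]

lemma empCov_add_const_left (hn : n ≠ 0) (f g : ℕ → ℝ) (t : ℝ) :
    empCov n (f + fun _ => t) g = empCov n f g := by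
  have h : (fun _ : ℕ => t) * g = t • g := rfl
  rw [empCov, empCov, add_mul, h, map_add, map_add, map_smul, empMean_const hn, smul_eq_mul]
  ring

lemma empCov_sub_smul_right (n : ℕ) (f g k : ℕ → ℝ) (t : ℝ) :
    empCov n f (g - t • k) = empCov n f g - t * empCov n f k := by
  simp only [empCov, mul_sub, mul_smul_comm, map_sub, map_smul, smul_eq_mul]
  ring

lemma empCov_self (f : ℕ → ℝ) (n : ℕ) :
    empCov n f f = empMean n (fun s => (f s - empMean n f) ^ 2) := by
  rcases eq_or_ne n 0 with rfl | hn
  · simp [empCov, empMean_apply]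
  · have h := empMean_mul_sub_sq (n := n) 1 f (empMean n f)
    simp only [one_mul, Pi.one_apply] at h
    rw [h, Pi.one_def, empMean_const hn, empCov, pow_two f]
    ring

lemma empCov_sq_le (n : ℕ) (f g : ℕ → ℝ) :
    empCov n f g ^ 2 ≤ empCov n f f * empMean n (g ^ 2) := by
  rw [empCov_self, empCov, ← empMean_sub_mean_mul]
  simp only [empMean_apply, mul_pow]
  calc (n : ℝ)⁻¹ ^ 2 * (∑ s ∈ Finset.range n, (f s - _) * g s) ^ 2
      ≤ (n : ℝ)⁻¹ ^ 2 *
          ((∑ s ∈ Finset.range n, (f s - _) ^ 2) * ∑ s ∈ Finset.range n, g s ^ 2) := by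
        gcongr
        exact Finset.sum_mul_sq_le_sq_mul_sq _ _ _
    _ = _ := by simp only [Pi.pow_apply]; ring

end EmpiricalMoments

lemma exists_pos_lt_mul_sub {a q ν : ℝ} (hν : 0 < ν) (h : a ^ 2 < ν * q) :
    ∃ c : ℝ, 0 < c ∧ c < ν ∧ a ^ 2 < (ν - c) * (q - c) := by
  have hprod : Tendsto (fun c : ℝ => (ν - c) * (q - c)) (𝓝[>] 0) (𝓝 (ν * q)) := by
    have : Continuous fun c : ℝ => (ν - c) * (q - c) := by fun_prop
    simpa using (this.tendsto 0).mono_left nhdsWithin_le_nhds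
  obtain ⟨c, hlt, hc, hcν⟩ := ((hprod.eventually_const_lt h).and (Ioo_mem_nhdsGT hν)).exists
  exact ⟨c, hc, hcν, hlt⟩

/-- A typical trajectory of the adaptive regression of `y s = -η x s + ε s` on the regressors
`x s`: the indicator `β` marks the exploratory regressors, all others (except the first) are equal
to the current least-squares estimate `e s` of the zero of `x ↦ -η x`. The running means of `β`,
`β x` and `β x ^ 2` converge to `ν`, `a` and `q`, that of `ε ^ 2` to `v`. -/
structure AdaptiveRegression (η ν a q v : ℝ) (x ε β e : ℕ → ℝ) : Prop where
  slope_ne_zero : η ≠ 0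
  frequency_pos : 0 < ν
  sq_lt : a ^ 2 < ν * q
  indicator : ∀ s, β s = 0 ∨ β s = 1
  exploited : ∀ s ≠ 0, β s = 0 → x s = e s
  estimate_eq : ∀ n, empCov n x x ≠ 0 → empCov n x ε - η * empCov n x x ≠ 0 →
    e n = (empMean n x * empCov n x ε - empCov n x x * empMean n ε) /
      (empCov n x ε - η * empCov n x x)
  tendsto_noise : Tendsto (fun n => empMean n ε) atTop (𝓝 0)
  tendsto_noise_sq : Tendsto (fun n => empMean n (ε ^ 2)) atTop (𝓝 v)
  tendsto_indicator : Tendsto (fun n => empMean n β) atTop (𝓝 ν)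
  tendsto_explored : Tendsto (fun n => empMean n (β * x)) atTop (𝓝 a)
  tendsto_explored_sq : Tendsto (fun n => empMean n (β * x ^ 2)) atTop (𝓝 q)
  eventually_transform_le : ∀ κ > 0, ∀ᶠ n in atTop,
    |empMean n (x * ε)| ≤ κ * (1 + empMean n (x ^ 2))

namespace AdaptiveRegression

variable {η ν a q v : ℝ} {x ε β e : ℕ → ℝ}

lemma explored_variance_le (h : AdaptiveRegression η ν a q v x ε β e) (n : ℕ) :
    empMean n (β * x ^ 2) - 2 * empMean n x * empMean n (β * x) + empMean n x ^ 2 * empMean n β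
      ≤ empCov n x x := by
  rw [← empMean_mul_sub_sq, empCov_self]
  refine empMean_mono fun s => ?_
  rcases h.indicator s with hs | hs <;> simp [hs, sq_nonneg]

lemma exists_mul_le_variance (h : AdaptiveRegression η ν a q v x ε β e) :
    ∃ c > 0, ∀ᶠ n in atTop, c * (1 + empMean n x ^ 2) ≤ empCov n x x := by
  obtain ⟨c, hc, hcν, hlt⟩ := exists_pos_lt_mul_sub h.frequency_pos h.sq_lt
  refine ⟨c, hc, ?_⟩
  have hdisc := ((h.tendsto_indicator.sub_const c).mul (h.tendsto_explored_sq.sub_const c)).sub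
    (h.tendsto_explored.pow 2)
  filter_upwards [hdisc.eventually_const_lt (sub_pos.2 hlt),
    h.tendsto_indicator.eventually_const_lt hcν] with n hn hνn
  refine le_trans ?_ (h.explored_variance_le n)
  -- the difference of the two sides is a quadratic polynomial in the mean, with discriminant `< 0`
  have hquad : 0 ≤ (empMean n β - c) * ((empMean n (β * x ^ 2) - c)
      - 2 * empMean n x * empMean n (β * x) + empMean n x ^ 2 * (empMean n β - c)) := by
    nlinarith [sq_nonneg ((empMean n β - c) * empMean n x - empMean n (β * x))]
  linarith [nonneg_of_mul_nonneg_right hquad (sub_pos.2 hνn)]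

lemma eventually_variance_pos (h : AdaptiveRegression η ν a q v x ε β e) :
    ∀ᶠ n in atTop, 0 < empCov n x x := by
  obtain ⟨c, hc, hvar⟩ := h.exists_mul_le_variance
  filter_upwards [hvar] with n hn
  exact lt_of_lt_of_le (by positivity) hn

lemma tendsto_cov_div_variance (h : AdaptiveRegression η ν a q v x ε β e) :
    Tendsto (fun n => empCov n x ε / empCov n x x) atTop (𝓝 0) := by
  obtain ⟨c, hc, hvar⟩ := h.exists_mul_le_variance
  rw [Metric.tendsto_nhds]
  intro ρ hρ
  have hκ : 0 < ρ / (1 + 2 / c) / 2 := by positivity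
  have hnoise := h.tendsto_noise.abs
  rw [abs_zero] at hnoise
  filter_upwards [hvar, h.eventually_variance_pos, h.eventually_transform_le _ hκ,
    hnoise.eventually_lt_const hκ] with n hn hpos htransform hE
  set κ := ρ / (1 + 2 / c) / 2 with hκdef
  set A := empMean n x
  set V := empCov n x x with hV
  have hQ : empMean n (x ^ 2) = V + A ^ 2 := by rw [hV, empCov, ← pow_two x]; ring
  rw [Real.dist_0_eq_abs, abs_div, abs_of_pos hpos, div_lt_iff₀ hpos]
  calc |empCov n x ε| ≤ κ * (1 + (V + A ^ 2)) + |A| * κ := by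
        rw [← hQ]
        refine (abs_sub _ _).trans (add_le_add htransform ?_)
        rw [abs_mul]
        gcongr
    _ ≤ κ * (V + 2 * (1 + A ^ 2)) := by
        have : |A| ≤ 1 + A ^ 2 := by nlinarith [sq_abs A, sq_nonneg (|A| - 1)]
        nlinarith
    _ ≤ κ * (V + 2 * (V / c)) := by
        gcongr
        rwa [le_div_iff₀' hc]
    _ = ρ / 2 * V := by rw [hκdef]; field_simp
    _ < ρ * V := by gcongr; exact half_lt_self hρ

lemma exists_abs_mean_mul_cov_div_variance_le (h : AdaptiveRegression η ν a q v x ε β e) :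
    ∃ B, ∀ᶠ n in atTop, |empMean n x * (empCov n x ε / empCov n x x)| ≤ B := by
  obtain ⟨c, hc, hvar⟩ := h.exists_mul_le_variance
  refine ⟨√((v + 1) / c), ?_⟩
  filter_upwards [hvar, h.eventually_variance_pos,
    h.tendsto_noise_sq.eventually_lt_const (lt_add_one v)] with n hn hpos hnoise
  refine Real.abs_le_sqrt ?_
  have hmean : empMean n x ^ 2 ≤ empCov n x x / c := by
    rw [le_div_iff₀' hc]
    linarith
  have hcov : empCov n x ε ^ 2 ≤ empCov n x x * (v + 1) :=
    (empCov_sq_le n x ε).trans (by gcongr)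
  calc (empMean n x * (empCov n x ε / empCov n x x)) ^ 2
      = empMean n x ^ 2 * empCov n x ε ^ 2 / empCov n x x ^ 2 := by ring
    _ ≤ empCov n x x / c * (empCov n x x * (v + 1)) / empCov n x x ^ 2 := by gcongr
    _ = (v + 1) / c := by field_simp

lemma tendsto_slope (h : AdaptiveRegression η ν a q v x ε β e) :
    Tendsto (fun n => empCov n x ε / empCov n x x - η) atTop (𝓝 (-η)) := by
  simpa using h.tendsto_cov_div_variance.sub_const η

lemma estimate_eventuallyEq (h : AdaptiveRegression η ν a q v x ε β e) :
    e =ᶠ[atTop] fun n => (empMean n x * (empCov n x ε / empCov n x x) - empMean n ε) /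
      (empCov n x ε / empCov n x x - η) := by
  filter_upwards [h.eventually_variance_pos,
    h.tendsto_slope.eventually_ne (neg_ne_zero.2 h.slope_ne_zero)] with n hpos hne
  have hsub : empCov n x ε - η * empCov n x x
      = (empCov n x ε / empCov n x x - η) * empCov n x x := by
    field_simp
  rw [h.estimate_eq n hpos.ne' (by rw [hsub]; exact mul_ne_zero hne hpos.ne'), hsub]
  field_simp

lemma isBigO_estimate (h : AdaptiveRegression η ν a q v x ε β e) :
    e =O[atTop] (1 : ℕ → ℝ) := by
  obtain ⟨B, hB⟩ := h.exists_abs_mean_mul_cov_div_variance_le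
  have hnum : (fun n => empMean n x * (empCov n x ε / empCov n x x) - empMean n ε)
      =O[atTop] (1 : ℕ → ℝ) :=
    (Asymptotics.IsBigO.of_bound B (by
      simpa only [Pi.one_apply, norm_one, mul_one, Real.norm_eq_abs] using hB)).sub
      (h.tendsto_noise.isBigO_one ℝ)
  have hden := (h.tendsto_slope.inv₀ (neg_ne_zero.2 h.slope_ne_zero)).isBigO_one ℝ
  refine h.estimate_eventuallyEq.trans_isBigO ?_
  simpa only [div_eq_mul_inv, mul_one] using hnum.mul hden

lemma abs_sub_explored_le (h : AdaptiveRegression η ν a q v x ε β e) {s : ℕ} (hs : s ≠ 0) :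
    |(x - β * x) s| ≤ |e s| := by
  rcases h.indicator s with hβ | hβ
  · simp [hβ, h.exploited s hs hβ]
  · simp [hβ]

lemma isBigO_mean (h : AdaptiveRegression η ν a q v x ε β e) :
    (fun n => empMean n x) =O[atTop] (1 : ℕ → ℝ) := by
  have hexploited : (x - β * x) =O[atTop] (1 : ℕ → ℝ) := by
    refine (Asymptotics.IsBigO.of_bound' ?_).trans h.isBigO_estimate
    filter_upwards [eventually_ne_atTop 0] with s hs
    exact h.abs_sub_explored_le hs
  obtain ⟨B, hB⟩ := ((Asymptotics.isBigO_one_iff ℝ).1 hexploited).bddAbove_range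
  have hmean : (fun n => empMean n (x - β * x)) =O[atTop] (1 : ℕ → ℝ) :=
    .of_bound B (.of_forall fun n => by simpa using abs_empMean_le fun s => hB ⟨s, rfl⟩)
  refine (hmean.add (h.tendsto_explored.isBigO_one ℝ)).congr_left fun n => ?_
  rw [map_sub, sub_add_cancel]

theorem tendsto_estimate (h : AdaptiveRegression η ν a q v x ε β e) :
    Tendsto e atTop (𝓝 0) := by
  have hmul : Tendsto (fun n => empMean n x * (empCov n x ε / empCov n x x)) atTop (𝓝 0) := by
    have := h.isBigO_mean.mul_isLittleO ((Asymptotics.isLittleO_one_iff ℝ).2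
      h.tendsto_cov_div_variance)
    simpa only [Pi.one_apply, mul_one, Asymptotics.isLittleO_one_iff] using this
  refine Tendsto.congr' h.estimate_eventuallyEq.symm ?_
  rw [← zero_div (-η), ← sub_zero (0 : ℝ)]
  exact (hmul.sub h.tendsto_noise).div h.tendsto_slope (neg_ne_zero.2 h.slope_ne_zero)

lemma tendsto_sub_explored (h : AdaptiveRegression η ν a q v x ε β e) :
    Tendsto (x - β * x) atTop (𝓝 0) := by
  refine squeeze_zero_norm' ?_ (by simpa using h.tendsto_estimate.abs)
  filter_upwards [eventually_ne_atTop 0] with s hs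
  exact h.abs_sub_explored_le hs

theorem tendsto_mean (h : AdaptiveRegression η ν a q v x ε β e) :
    Tendsto (fun n => empMean n x) atTop (𝓝 a) := by
  have := h.tendsto_explored.add (tendsto_empMean h.tendsto_sub_explored)
  simpa only [← map_add, add_sub_cancel, add_zero] using this

theorem tendsto_mean_sq (h : AdaptiveRegression η ν a q v x ε β e) :
    Tendsto (fun n => empMean n (x ^ 2)) atTop (𝓝 q) := by
  have hsq : β * x ^ 2 + (x - β * x) ^ 2 = x ^ 2 := by
    ext s
    rcases h.indicator s with hs | hs <;> simp [hs]
  have hexploited : Tendsto ((x - β * x) ^ 2) atTop (𝓝 0) := by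
    have := h.tendsto_sub_explored.pow 2
    rwa [zero_pow two_ne_zero] at this
  simpa only [← map_add, hsq, add_zero] using
    h.tendsto_explored_sq.add (tendsto_empMean hexploited)

theorem tendsto_variance (h : AdaptiveRegression η ν a q v x ε β e) :
    Tendsto (fun n => empCov n x x) atTop (𝓝 (q - a ^ 2)) := by
  simpa only [empCov, ← pow_two] using h.tendsto_mean_sq.sub (h.tendsto_mean.pow 2)

theorem tendsto_cov (h : AdaptiveRegression η ν a q v x ε β e) :
    Tendsto (fun n => empCov n x ε) atTop (𝓝 0) := by
  have := h.tendsto_cov_div_variance.mul h.tendsto_variance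
  rw [zero_mul] at this
  refine this.congr' ?_
  filter_upwards [h.eventually_variance_pos] with n hn
  exact div_mul_cancel₀ _ hn.ne'

lemma variance_pos (h : AdaptiveRegression η ν a q v x ε β e) : 0 < q - a ^ 2 := by
  obtain ⟨c, hc, hvar⟩ := h.exists_mul_le_variance
  refine hc.trans_le (ge_of_tendsto h.tendsto_variance (hvar.mono fun n hn => hn.trans' ?_))
  exact le_mul_of_one_le_right hc.le (le_add_of_nonneg_right (sq_nonneg _))

lemma tendsto_denominator (h : AdaptiveRegression η ν a q v x ε β e) :
    Tendsto (fun n => empCov n x ε - η * empCov n x x) atTop (𝓝 (-(η * (q - a ^ 2)))) := by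
  simpa using h.tendsto_cov.sub (h.tendsto_variance.const_mul η)

lemma denominator_limit_ne_zero (h : AdaptiveRegression η ν a q v x ε β e) :
    -(η * (q - a ^ 2)) ≠ 0 :=
  neg_ne_zero.2 (mul_ne_zero h.slope_ne_zero h.variance_pos.ne')

lemma estimate_eventuallyEq_moments (h : AdaptiveRegression η ν a q v x ε β e) :
    e =ᶠ[atTop] fun n => empMean n x / (empCov n x ε - η * empCov n x x) * empMean n (x * ε)
      + -empMean n (x ^ 2) / (empCov n x ε - η * empCov n x x) * empMean n ε := by
  filter_upwards [h.eventually_variance_pos,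
    h.tendsto_denominator.eventually_ne h.denominator_limit_ne_zero] with n hpos hne
  rw [h.estimate_eq n hpos.ne' hne, div_mul_eq_mul_div, div_mul_eq_mul_div, ← add_div]
  congr 1
  rw [empCov, empCov, ← pow_two x]
  ring

end AdaptiveRegression

namespace LendingPool

section LeastSquares

variable {n : ℕ} {r y : ℕ → ℝ}

lemma gram_designMatrix (n : ℕ) (r : ℕ → ℝ) :
    (designMatrix n r).transpose * designMatrix n r
      = (n : ℝ) • !![1, empMean n r; empMean n r, empMean n (r ^ 2)] := by
  rcases eq_or_ne n 0 with rfl | hn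
  · simp
  · ext i j
    fin_cases i <;> fin_cases j <;>
      simp [designMatrix, Matrix.mul_apply, empMean_apply, Finset.sum_range, sq, hn]

lemma transpose_designMatrix_mulVec (hn : n ≠ 0) (r y : ℕ → ℝ) :
    (designMatrix n r).transpose.mulVec (fun i : Fin n => y i)
      = (n : ℝ) • ![empMean n y, empMean n (r * y)] := by
  ext i
  fin_cases i <;>
    simp [designMatrix, Matrix.mulVec, dotProduct, empMean_apply, Finset.sum_range, hn]

lemma det_gram_designMatrix (n : ℕ) (r : ℕ → ℝ) :
    ((designMatrix n r).transpose * designMatrix n r).det = n ^ 2 * empCov n r r := by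
  rw [gram_designMatrix, Matrix.det_smul, Matrix.det_fin_two_of, empCov, pow_two r,
    Fintype.card_fin, one_mul]

lemma isUnit_det_gram_iff :
    IsUnit ((designMatrix n r).transpose * designMatrix n r).det ↔ empCov n r r ≠ 0 := by
  rw [det_gram_designMatrix, isUnit_iff_ne_zero]
  rcases eq_or_ne n 0 with rfl | hn
  · simp [empCov, empMean_apply]
  · simp [hn]

lemma lsCoeff_eq (h : empCov n r r ≠ 0) (y : ℕ → ℝ) :
    lsCoeff n r y = ![empMean n y - empCov n r y / empCov n r r * empMean n r,
      empCov n r y / empCov n r r] := by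
  have hn : n ≠ 0 := by
    rintro rfl
    simp [empCov, empMean_apply] at h
  have hnormal : ((designMatrix n r).transpose * designMatrix n r).mulVec
      ![empMean n y - empCov n r y / empCov n r r * empMean n r, empCov n r y / empCov n r r]
      = (designMatrix n r).transpose.mulVec fun i : Fin n => y i := by
    have hsq : empMean n (r ^ 2) = empCov n r r + empMean n r * empMean n r := by
      rw [empCov, pow_two]
      ring
    have hmul : empMean n (r * y) = empCov n r y + empMean n r * empMean n y := by
      rw [empCov]
      ring
    rw [gram_designMatrix, transpose_designMatrix_mulVec hn, Matrix.smul_mulVec, hsq, hmul]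
    congr 1
    ext i
    fin_cases i <;> simp [Matrix.mulVec, dotProduct] <;> field_simp <;> ring
  rw [lsCoeff, ← hnormal, Matrix.mulVec_mulVec, Matrix.nonsing_inv_mul _ (isUnit_det_gram_iff.2 h),
    Matrix.one_mulVec]

lemma lsEstimator_eq (n : ℕ) (r y : ℕ → ℝ) : lsEstimator n r y =
    if empCov n r r ≠ 0 ∧ empCov n r y ≠ 0 then
      empMean n r - empMean n y * empCov n r r / empCov n r y
    else r (n - 1) := by
  rw [lsEstimator]
  simp only [isUnit_det_gram_iff]
  by_cases hr : empCov n r r = 0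
  · simp [hr]
  by_cases hy : empCov n r y = 0
  · simp [hy, lsCoeff_eq hr]
  rw [if_pos ⟨hr, by simp [lsCoeff_eq hr, hr, hy]⟩, if_pos ⟨hr, hy⟩, lsCoeff_eq hr]
  simp only [Matrix.cons_val_zero, Matrix.cons_val_one]
  field_simp
  ring

lemma lsEstimator_sub_eq {η ρ : ℝ} {x ε : ℕ → ℝ} (hx : empCov n x x ≠ 0)
    (hxε : empCov n x ε - η * empCov n x x ≠ 0) (hr : ∀ s, r s = x s + ρ)
    (hy : ∀ s, y s = η * (ρ - r s) + ε s) :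
    lsEstimator n r y - ρ = (empMean n x * empCov n x ε - empCov n x x * empMean n ε) /
      (empCov n x ε - η * empCov n x x) := by
  have hn : n ≠ 0 := by
    rintro rfl
    simp [empCov, empMean_apply] at hx
  obtain rfl : r = x + fun _ => ρ := funext hr
  obtain rfl : y = ε - η • x := funext fun s => by
    rw [hy s]
    simp only [Pi.add_apply, Pi.sub_apply, Pi.smul_apply, smul_eq_mul]
    ring
  have hcov : empCov n (x + fun _ => ρ) (x + fun _ => ρ) = empCov n x x := by
    rw [empCov_add_const_left hn, empCov_comm, empCov_add_const_left hn]
  have hslope : empCov n (x + fun _ => ρ) (ε - η • x) = empCov n x ε - η * empCov n x x := by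
    rw [empCov_add_const_left hn, empCov_sub_smul_right]
  rw [lsEstimator_eq, hcov, hslope, if_pos ⟨hx, hxε⟩, map_add, empMean_const hn, map_sub, map_smul,
    smul_eq_mul]
  field_simp
  ring

lemma lsEstimator_congr {r' y' : ℕ → ℝ} (hn : n ≠ 0) (hr : ∀ s < n, r s = r' s)
    (hy : ∀ s < n, y s = y' s) : lsEstimator n r y = lsEstimator n r' y' := by
  simp only [lsEstimator_eq, empCov_congr hr hr, empCov_congr hr hy, empMean_congr hr,
    empMean_congr hy, hr (n - 1) (Nat.sub_one_lt hn)]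

lemma measurable_lsEstimator (n : ℕ) :
    Measurable fun p : (ℕ → ℝ) × (ℕ → ℝ) => lsEstimator n p.1 p.2 := by
  have hrr : Measurable fun p : (ℕ → ℝ) × (ℕ → ℝ) => empCov n p.1 p.1 :=
    (measurable_empCov n).comp (measurable_fst.prodMk measurable_fst)
  have hmean := measurable_empMean n
  simp only [lsEstimator_eq]
  refine Measurable.ite ((hrr (measurableSet_singleton 0).compl).inter
    (measurable_empCov n (measurableSet_singleton 0).compl)) ?_ (by fun_prop)
  exact (hmean.comp measurable_fst).sub
    (((hmean.comp measurable_snd).mul hrr).div (measurable_empCov n))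

end LeastSquares

end LendingPool

lemma lintegral_mul_exp_le {Ω : Type*} {mΩ : MeasurableSpace Ω} {P : Measure Ω}
    [IsProbabilityMeasure P] {F : Ω → ℝ≥0∞} {H X : Ω → ℝ} {v : ℝ≥0} (hF : AEMeasurable F P)
    (hH : AEMeasurable H P) (hX : HasSubgaussianMGF X v P)
    (hind : IndepFun (fun ω => (F ω, H ω)) X P) :
    ∫⁻ ω, F ω * ENNReal.ofReal (Real.exp (H ω * X ω - v / 2 * H ω ^ 2)) ∂P ≤ ∫⁻ ω, F ω ∂P := by
  have hFH := hF.prodMk hH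
  have hprod := (indepFun_iff_map_prod_eq_prod_map_map hFH hX.aemeasurable).1 hind
  have := Measure.isProbabilityMeasure_map hX.aemeasurable
  let g : (ℝ≥0∞ × ℝ) × ℝ → ℝ≥0∞ := fun p =>
    p.1.1 * ENNReal.ofReal (Real.exp (p.1.2 * p.2 - v / 2 * p.1.2 ^ 2))
  have hg : Measurable g := by fun_prop
  have hinner (p : ℝ≥0∞ × ℝ) : ∫⁻ x, g (p, x) ∂(P.map X) ≤ p.1 := by
    change ∫⁻ x, p.1 * ENNReal.ofReal (Real.exp (p.2 * x - v / 2 * p.2 ^ 2)) ∂(P.map X) ≤ p.1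
    rw [lintegral_const_mul _ (by fun_prop), lintegral_map' (by fun_prop) hX.aemeasurable,
      ← ofReal_integral_eq_lintegral_ofReal
        (by simpa only [Real.exp_sub, div_eq_mul_inv] using (hX.integrable_exp_mul p.2).mul_const _)
        (ae_of_all _ fun _ => (Real.exp_pos _).le)]
    refine mul_le_of_le_one_right' (ENNReal.ofReal_le_one.2 ?_)
    simp only [Real.exp_sub, integral_div]
    rw [div_le_one (Real.exp_pos _)]
    exact (hX.mgf_le p.2).trans_eq (by ring_nf)
  calc ∫⁻ ω, g ((F ω, H ω), X ω) ∂P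
      = ∫⁻ p, ∫⁻ x, g (p, x) ∂(P.map X) ∂(P.map fun ω => (F ω, H ω)) := by
        rw [← lintegral_prod _ hg.aemeasurable, ← hprod,
          lintegral_map' hg.aemeasurable (hFH.prodMk hX.aemeasurable)]
    _ ≤ ∫⁻ p, p.1 ∂(P.map fun ω => (F ω, H ω)) := lintegral_mono hinner
    _ = ∫⁻ ω, F ω ∂P := lintegral_map' measurable_fst.aemeasurable hFH

/-- Noise `ε` along a filtration: `ε s` is revealed at time `s + 1`, is independent of the
information available at time `s`, and is sub-Gaussian with variance proxy `v`. -/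
structure IsSubgaussianNoise {Ω : Type*} {mΩ : MeasurableSpace Ω} (P : Measure Ω)
    (ℱ : Filtration ℕ mΩ) (ε : ℕ → Ω → ℝ) (v : ℝ≥0) : Prop where
  measurable_succ : ∀ s, Measurable[ℱ (s + 1)] (ε s)
  indep : ∀ s, Indep (ℱ s) (MeasurableSpace.comap (ε s) inferInstance) P
  hasSubgaussianMGF : ∀ s, HasSubgaussianMGF (ε s) v P

namespace IsSubgaussianNoise

variable {Ω : Type*} {mΩ : MeasurableSpace Ω} {P : Measure Ω} {ℱ : Filtration ℕ mΩ}
  {ε H : ℕ → Ω → ℝ} {v : ℝ≥0}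

lemma indepFun (hε : IsSubgaussianNoise P ℱ ε v) {β : Type*} [MeasurableSpace β] {s : ℕ}
    {F : Ω → β} (hF : Measurable[ℱ s] F) : IndepFun F (ε s) P := by
  rw [IndepFun_iff_Indep]
  exact indep_of_indep_of_le_left (hε.indep s) hF.comap_le

variable [IsProbabilityMeasure P]

/-- As a Lebesgue integral, the bound for the exponential supermartingale holds without any moment
of `H`. -/
lemma lintegral_exp_sum_le_one (hε : IsSubgaussianNoise P ℱ ε v)
    (hH : ∀ s, Measurable[ℱ s] (H s)) (n : ℕ) :
    ∫⁻ ω, ENNReal.ofReal (Real.exp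
      (∑ s ∈ Finset.range n, (H s ω * ε s ω - v / 2 * H s ω ^ 2))) ∂P ≤ 1 := by
  induction n with
  | zero => simp
  | succ n ih =>
    have hF : Measurable[ℱ n] fun ω => ENNReal.ofReal (Real.exp
        (∑ s ∈ Finset.range n, (H s ω * ε s ω - v / 2 * H s ω ^ 2))) := by
      refine ENNReal.measurable_ofReal.comp (Real.measurable_exp.comp
        (Finset.measurable_fun_sum _ fun s hs => ?_))
      have hsn : s + 1 ≤ n := Finset.mem_range.1 hs
      have hHs := (hH s).mono (ℱ.mono (s.le_succ.trans hsn)) le_rfl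
      exact (hHs.mul ((hε.measurable_succ s).mono (ℱ.mono hsn) le_rfl)).sub
        ((hHs.pow_const 2).const_mul _)
    refine le_trans ?_ ih
    simp only [Finset.sum_range_succ, Real.exp_add, ENNReal.ofReal_mul (Real.exp_pos _).le]
    exact lintegral_mul_exp_le (hF.mono (ℱ.le n) le_rfl).aemeasurable
      ((hH n).mono (ℱ.le n) le_rfl).aemeasurable (hε.hasSubgaussianMGF n)
      (hε.indepFun (hF.prodMk (hH n)))

lemma measure_le_mul_sum_sub_le (hε : IsSubgaussianNoise P ℱ ε v)
    (hH : ∀ s, Measurable[ℱ s] (H s)) (n : ℕ) (l b : ℝ) :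
    P {ω | b ≤ l * ∑ s ∈ Finset.range n, H s ω * ε s ω
      - v / 2 * l ^ 2 * ∑ s ∈ Finset.range n, H s ω ^ 2} ≤ ENNReal.ofReal (Real.exp (-b)) := by
  have hexp := hε.lintegral_exp_sum_le_one (fun s => (hH s).const_mul l) n
  have heq (ω : Ω) : ∑ s ∈ Finset.range n, (l * H s ω * ε s ω - v / 2 * (l * H s ω) ^ 2)
      = l * ∑ s ∈ Finset.range n, H s ω * ε s ω
        - v / 2 * l ^ 2 * ∑ s ∈ Finset.range n, H s ω ^ 2 := by
    rw [Finset.sum_sub_distrib, Finset.mul_sum, Finset.mul_sum]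
    congr 1 <;> exact Finset.sum_congr rfl fun s _ => by ring
  simp only [heq] at hexp
  set S : Ω → ℝ := fun ω => l * ∑ s ∈ Finset.range n, H s ω * ε s ω
    - v / 2 * l ^ 2 * ∑ s ∈ Finset.range n, H s ω ^ 2
  have hS : Measurable S := by
    have hε' s := (hε.measurable_succ s).mono (ℱ.le _) le_rfl
    have hH' s := (hH s).mono (ℱ.le _) le_rfl
    fun_prop
  calc P {ω | b ≤ S ω}
      = P {ω | ENNReal.ofReal (Real.exp b) ≤ ENNReal.ofReal (Real.exp (S ω))} := by
        simp only [ENNReal.ofReal_le_ofReal_iff (Real.exp_pos _).le, Real.exp_le_exp]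
    _ ≤ (∫⁻ ω, ENNReal.ofReal (Real.exp (S ω)) ∂P) / ENNReal.ofReal (Real.exp b) :=
        meas_ge_le_lintegral_div (by fun_prop) (by simp [Real.exp_pos]) ENNReal.ofReal_ne_top
    _ ≤ 1 / ENNReal.ofReal (Real.exp b) := by gcongr
    _ = ENNReal.ofReal (Real.exp (-b)) := by
        rw [one_div, Real.exp_neg, ENNReal.ofReal_inv_of_pos (Real.exp_pos b)]

lemma measure_le_mul_abs_sum_sub_le (hε : IsSubgaussianNoise P ℱ ε v)
    (hH : ∀ s, Measurable[ℱ s] (H s)) (n : ℕ) (l b : ℝ) :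
    P {ω | b ≤ l * |∑ s ∈ Finset.range n, H s ω * ε s ω|
      - v / 2 * l ^ 2 * ∑ s ∈ Finset.range n, H s ω ^ 2} ≤ 2 * ENNReal.ofReal (Real.exp (-b)) := by
  refine (measure_mono fun ω hω => ?_).trans ((measure_union_le _ _).trans ((add_le_add
    (hε.measure_le_mul_sum_sub_le hH n l b)
    (hε.measure_le_mul_sum_sub_le hH n (-l) b)).trans_eq (two_mul _).symm))
  simp only [Set.mem_ofPred_eq, Set.mem_union] at hω ⊢
  rcases abs_cases (∑ s ∈ Finset.range n, H s ω * ε s ω) with h | h <;> rw [h.1] at hω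
  · exact .inl hω
  · exact .inr (by linarith)

/-- The Chernoff bound for the self-normalised sum decays geometrically, however large `H` is. -/
lemma ae_eventually_abs_sum_le (hε : IsSubgaussianNoise P ℱ ε v)
    (hH : ∀ s, Measurable[ℱ s] (H s)) {κ : ℝ} (hκ : 0 < κ) :
    ∀ᵐ ω ∂P, ∀ᶠ n : ℕ in atTop,
      |∑ s ∈ Finset.range n, H s ω * ε s ω| ≤ κ * (n + ∑ s ∈ Finset.range n, H s ω ^ 2) := by
  set l : ℝ := κ / (v + 1) with hl
  have hl0 : 0 < l := by positivity
  have hlv : v / 2 * l ≤ κ := by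
    rw [hl, div_mul_div_comm, div_le_iff₀ (by positivity)]
    nlinarith [v.coe_nonneg]
  have hsum : ∑' n : ℕ, P {ω | l * κ * n ≤ l * |∑ s ∈ Finset.range n, H s ω * ε s ω|
      - v / 2 * l ^ 2 * ∑ s ∈ Finset.range n, H s ω ^ 2} ≠ ∞ := by
    refine ne_top_of_le_ne_top ?_
      (ENNReal.tsum_le_tsum fun n => hε.measure_le_mul_abs_sum_sub_le hH n _ _)
    rw [ENNReal.tsum_mul_left]
    refine ENNReal.mul_ne_top ENNReal.ofNat_ne_top (Summable.tsum_ofReal_ne_top ?_)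
    simpa only [mul_comm (_ : ℝ) ((_ : ℕ) : ℝ), neg_mul_eq_mul_neg] using
      Real.summable_exp_nat_mul_iff.2 (neg_neg_of_pos (mul_pos hl0 hκ))
  filter_upwards [ae_eventually_notMem hsum] with ω hω
  filter_upwards [hω] with n hn
  rw [not_le] at hn
  have henergy : 0 ≤ ∑ s ∈ Finset.range n, H s ω ^ 2 := by positivity
  refine le_of_mul_le_mul_left ?_ hl0
  nlinarith [mul_le_mul_of_nonneg_right hlv (mul_nonneg hl0.le henergy)]

theorem ae_eventually_abs_empMean_le (hε : IsSubgaussianNoise P ℱ ε v)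
    (hH : ∀ s, Measurable[ℱ s] (H s)) :
    ∀ᵐ ω ∂P, ∀ κ > 0, ∀ᶠ n in atTop,
      |empMean n ((H · ω) * (ε · ω))| ≤ κ * (1 + empMean n ((H · ω) ^ 2)) := by
  obtain ⟨u, -, hu, hu0⟩ := exists_seq_strictAnti_tendsto (0 : ℝ)
  filter_upwards [ae_all_iff.2 fun j => hε.ae_eventually_abs_sum_le hH (hu j)] with ω hω κ hκ
  obtain ⟨j, hj⟩ := (hu0.eventually_lt_const hκ).exists
  filter_upwards [hω j, eventually_ne_atTop 0] with n hn hn0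
  simp only [empMean_apply, Pi.mul_apply, Pi.pow_apply, abs_mul, abs_inv, Nat.abs_cast]
  calc (n : ℝ)⁻¹ * |∑ s ∈ Finset.range n, H s ω * ε s ω|
      ≤ (n : ℝ)⁻¹ * (κ * (n + ∑ s ∈ Finset.range n, H s ω ^ 2)) := by
        gcongr
        exact hn.trans (by gcongr)
    _ = κ * (1 + (n : ℝ)⁻¹ * ∑ s ∈ Finset.range n, H s ω ^ 2) := by field_simp

lemma measure_le_mul_abs_sqrt_mul_empMean_sub_le (hε : IsSubgaussianNoise P ℱ ε v)
    (hH : ∀ s, Measurable[ℱ s] (H s)) (n : ℕ) (L b : ℝ) :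
    P {ω | b ≤ L * |√n * empMean n ((H · ω) * (ε · ω))|
      - v / 2 * L ^ 2 * empMean n ((H · ω) ^ 2)} ≤ 2 * ENNReal.ofReal (Real.exp (-b)) := by
  convert hε.measure_le_mul_abs_sum_sub_le hH n (L / √n) b using 6 with ω
  · rw [empMean_apply, abs_mul, abs_mul, abs_of_nonneg (Real.sqrt_nonneg _), abs_inv, Nat.abs_cast,
      ← mul_assoc √(n : ℝ), ← div_eq_mul_inv, Real.sqrt_div_self, div_eq_mul_inv L, mul_assoc]
    rfl
  · rw [empMean_apply, div_pow, Real.sq_sqrt n.cast_nonneg, mul_div_assoc',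
      div_eq_mul_inv _ (n : ℝ), mul_assoc _ (n : ℝ)⁻¹]
    rfl

theorem tendstoInMeasure_sqrt_mul_empMean (hε : IsSubgaussianNoise P ℱ ε v)
    (hH : ∀ s, Measurable[ℱ s] (H s))
    (henergy : TendstoInMeasure P (fun n ω => empMean n ((H · ω) ^ 2)) atTop 0) :
    TendstoInMeasure P (fun (n : ℕ) ω => √n * empMean n ((H · ω) * (ε · ω))) atTop 0 := by
  rw [tendstoInMeasure_iff_norm] at henergy ⊢
  intro κ hκ
  rw [ENNReal.tendsto_nhds_zero]
  intro δ hδ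
  have hlim : Tendsto (fun L : ℝ => 2 * ENNReal.ofReal (Real.exp (-(L * κ - 1)))) atTop (𝓝 0) := by
    have : Tendsto (fun L : ℝ => L * κ - 1) atTop atTop :=
      tendsto_atTop_add_const_right _ _ (tendsto_id.atTop_mul_const hκ)
    simpa using ENNReal.Tendsto.const_mul
      (ENNReal.tendsto_ofReal (Real.tendsto_exp_neg_atTop_nhds_zero.comp this)) (a := 2) (by simp)
  obtain ⟨L, hLpos, hL⟩ := ((eventually_gt_atTop 0).and
    (hlim.eventually_le_const (ENNReal.half_pos hδ.ne'))).exists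
  set ρ : ℝ := 1 / (v + 1) / L ^ 2 with hρ
  have hρL : v / 2 * L ^ 2 * ρ ≤ 1 := by
    have : (v : ℝ) / (v + 1) ≤ 1 := div_le_one_of_le₀ (by linarith) (by positivity)
    calc v / 2 * L ^ 2 * ρ = v / (v + 1) / 2 := by rw [hρ]; field_simp
      _ ≤ 1 := by linarith
  filter_upwards [(henergy ρ (by positivity)).eventually_le_const (ENNReal.half_pos hδ.ne')]
    with n hn
  refine (measure_mono fun ω hω => ?_).trans ((measure_union_le _ _).trans ((add_le_add hn
    ((hε.measure_le_mul_abs_sqrt_mul_empMean_sub_le hH n L (L * κ - 1)).trans hL)).trans_eq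
    (ENNReal.add_halves δ)))
  rw [Set.mem_union, or_iff_not_imp_left]
  simp only [Set.mem_ofPred_eq, Pi.zero_apply, sub_zero, not_le, Real.norm_eq_abs] at hω ⊢
  intro hsmall
  have hsmall' : v / 2 * L ^ 2 * empMean n ((H · ω) ^ 2) ≤ 1 := by
    refine le_trans ?_ hρL
    gcongr
    exact (le_abs_self _).trans hsmall.le
  linarith [mul_le_mul_of_nonneg_left hω hLpos.le]

end IsSubgaussianNoise

lemma hasSubgaussianMGF_id_gaussianReal (v : ℝ≥0) : HasSubgaussianMGF id v (gaussianReal 0 v) :=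
  ⟨integrable_exp_mul_gaussianReal, fun u => by simp [mgf_id_gaussianReal]⟩

lemma ae_ne_of_indepFun {Ω E : Type*} {mΩ : MeasurableSpace Ω} [MeasurableSpace E] [MeasurableEq E]
    {P : Measure Ω} [IsFiniteMeasure P] {F X : Ω → E} (hF : AEMeasurable F P)
    (hX : AEMeasurable X P) [NullSingletonClass (P.map X)] (h : IndepFun F X P) :
    ∀ᵐ ω ∂P, X ω ≠ F ω := by
  have hdiag : MeasurableSet {p : E × E | p.2 ≠ p.1} :=
    (measurableSet_eq_fun measurable_snd measurable_fst).compl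
  refine ae_of_ae_map (hF.prodMk hX) (p := fun p : E × E => p.2 ≠ p.1) ?_
  rw [(indepFun_iff_map_prod_eq_prod_map_map hF hX).1 h, Measure.ae_prod_iff_ae_ae hdiag]
  exact ae_of_all _ fun x => Measure.ae_ne _ x

namespace LendingPool

section Information

/-- The information available at the beginning of each slot. -/
def slotFiltration : Filtration ℕ (inferInstance : MeasurableSpace (ℕ → Slot)) where
  seq t := ⨆ i ∈ Set.Iio t, MeasurableSpace.comap (fun ω : ℕ → Slot => ω i) inferInstance
  mono' _ _ hst := biSup_mono fun _ hi => lt_of_lt_of_le hi hst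
  le' _ := iSup₂_le fun i _ => (measurable_pi_apply i).comap_le

lemma measurable_slot (t : ℕ) : Measurable[slotFiltration (t + 1)] fun ω : ℕ → Slot => ω t :=
  Measurable.of_comap_le (le_iSup₂_of_le (f := fun i (_ : i ∈ Set.Iio (t + 1)) =>
    MeasurableSpace.comap (fun ω : ℕ → Slot => ω i) inferInstance) t t.lt_succ_self le_rfl)

/-- The noise in the borrowers' behaviour. -/
def noise (t : ℕ) (ω : ℕ → Slot) : ℝ := (ω t).2.1

lemma measurable_noise (t : ℕ) : Measurable[slotFiltration (t + 1)] (noise t) :=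
  (measurable_fst.comp measurable_snd).comp (measurable_slot t)

variable (m : Market) (K : Controller)

instance : IsProbabilityMeasure (poolLaw m K) := by
  unfold poolLaw
  infer_instance

lemma iIndepFun_slot : iIndepFun (fun t (ω : ℕ → Slot) => ω t) (poolLaw m K) :=
  iIndepFun_infinitePi (X := fun _ x => x) fun _ => measurable_id

lemma measurePreserving_slot (t : ℕ) :
    MeasurePreserving (fun ω : ℕ → Slot => ω t) (poolLaw m K) (slotLaw m K) :=
  measurePreserving_eval_infinitePi (fun _ => slotLaw m K) t

lemma measurePreserving_slotNoise :
    MeasurePreserving (fun x : Slot => x.2.1) (slotLaw m K) (gaussianReal 0 (m.ζ ^ 2)) :=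
  measurePreserving_fst.comp measurePreserving_snd

lemma hasLaw_noise (t : ℕ) : HasLaw (noise t) (gaussianReal 0 (m.ζ ^ 2)) (poolLaw m K) :=
  ((measurePreserving_slotNoise m K).comp (measurePreserving_slot m K t)).hasLaw

lemma indep_slotFiltration_noise (t : ℕ) :
    Indep (slotFiltration t) (MeasurableSpace.comap (noise t) inferInstance) (poolLaw m K) := by
  have h := indep_iSup_of_disjoint (fun i => (measurable_pi_apply i).comap_le)
    (iIndepFun_slot m K).iIndep (S := Set.Iio t) (T := {t}) (by simp)
  rw [iSup_singleton] at h
  have hnoise : Measurable[MeasurableSpace.comap (fun ω : ℕ → Slot => ω t) inferInstance]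
      (noise t) := (measurable_fst.comp measurable_snd).comp (comap_measurable _)
  exact indep_of_indep_of_le_right h hnoise.comap_le

lemma isSubgaussianNoise : IsSubgaussianNoise (poolLaw m K) slotFiltration noise (m.ζ ^ 2) where
  measurable_succ := measurable_noise
  indep := indep_slotFiltration_noise m K
  hasSubgaussianMGF t := by
    rw [← HasSubgaussianMGF.id_map_iff (hasLaw_noise m K t).aemeasurable,
      (hasLaw_noise m K t).map_eq]
    exact hasSubgaussianMGF_id_gaussianReal _

lemma memLp_noise (t : ℕ) (p : ℝ≥0) : MemLp (noise t) p (poolLaw m K) :=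
  (memLp_id_gaussianReal p).comp_measurePreserving
    ((measurePreserving_slotNoise m K).comp (measurePreserving_slot m K t))

lemma integrable_noise (t : ℕ) : Integrable (noise t) (poolLaw m K) :=
  (memLp_noise m K t 1).integrable le_rfl

lemma integral_noise (t : ℕ) : ∫ ω, noise t ω ∂(poolLaw m K) = 0 :=
  (hasLaw_noise m K t).integral_eq.trans integral_id_gaussianReal

lemma integrable_empMean_noise (n : ℕ) :
    Integrable (fun ω => empMean n (noise · ω)) (poolLaw m K) := by
  simp only [empMean_apply]
  exact (integrable_finsetSum _ fun s _ => integrable_noise m K s).const_mul _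

lemma integral_empMean_noise (n : ℕ) : ∫ ω, empMean n (noise · ω) ∂(poolLaw m K) = 0 := by
  simp only [empMean_apply]
  rw [integral_const_mul, integral_finsetSum _ fun s _ => integrable_noise m K s]
  simp [integral_noise]

end Information

/-- The estimator uses only the first `n` samples. -/
def Estimator.IsLocal (est : Estimator) : Prop :=
  ∀ n ≠ 0, ∀ r r' y y' : ℕ → ℝ, (∀ s < n, r s = r' s) → (∀ s < n, y s = y' s) →
    est n r y = est n r' y'

lemma lsEstimator_isLocal : lsEstimator.IsLocal := fun _ hn _ _ _ _ => lsEstimator_congr hn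

section Trajectory

variable (m : Market) (est : Estimator) (r₀ p₀ B₀ : ℝ) (ω : ℕ → Slot)

/-- The interest rate of slot `t`. -/
def rate (t : ℕ) : ℝ := (trajectory m est r₀ p₀ B₀ ω t).rate t

/-- The relative change of the debt in slot `t`. -/
def growth (t : ℕ) : ℝ := (trajectory m est r₀ p₀ B₀ ω (t + 1)).growth t

variable {m est r₀ p₀ B₀ ω} {s t : ℕ}

lemma trajectory_price_pos (hp : 0 < p₀) (t : ℕ) : 0 < (trajectory m est r₀ p₀ B₀ ω t).price := by
  induction t with
  | zero => exact hp
  | succ t ih => exact mul_pos ih (Real.exp_pos _)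

lemma trajectory_rate_eq (h : s ≤ t) :
    (trajectory m est r₀ p₀ B₀ ω t).rate s = rate m est r₀ p₀ B₀ ω s := by
  induction t, h using Nat.le_induction with
  | base => rfl
  | succ t hst ih => simp [trajectory, step, Function.update_of_ne (by lia : s ≠ t + 1), ih]

lemma trajectory_growth_eq (h : s < t) :
    (trajectory m est r₀ p₀ B₀ ω t).growth s = growth m est r₀ p₀ B₀ ω s := by
  induction t, Nat.succ_le_of_lt h using Nat.le_induction with
  | base => rfl
  | succ t hst ih => simp [trajectory, step, Function.update_of_ne (by lia : s ≠ t), ih (by lia)]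

lemma trajectory_debt_succ (hp : 0 < p₀) (t : ℕ) :
    (trajectory m est r₀ p₀ B₀ ω (t + 1)).debt = (trajectory m est r₀ p₀ B₀ ω t).debt *
      (1 + (m.η * (m.equilibriumRate - rate m est r₀ p₀ B₀ ω t) + noise t ω)) := by
  rw [mul_one_add, rate, noise, ← m.drift_eq _ _ (trajectory_price_pos hp t)]
  rfl

lemma growth_eq (hp : 0 < p₀) (hB : (trajectory m est r₀ p₀ B₀ ω t).debt ≠ 0) :
    growth m est r₀ p₀ B₀ ω t
      = m.η * (m.equilibriumRate - rate m est r₀ p₀ B₀ ω t) + noise t ω := by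
  have hdef : growth m est r₀ p₀ B₀ ω t = ((trajectory m est r₀ p₀ B₀ ω (t + 1)).debt -
      (trajectory m est r₀ p₀ B₀ ω t).debt) / (trajectory m est r₀ p₀ B₀ ω t).debt := by
    simp [growth, trajectory, step]
  rw [hdef, trajectory_debt_succ hp, mul_one_add, add_sub_cancel_left, mul_div_cancel_left₀ _ hB]

lemma stoppedRate_eq (hloc : est.IsLocal) {τ : ℕ} (hτ : τ ≠ 0) :
    stoppedRate m est r₀ p₀ B₀ τ ω
      = est τ (rate m est r₀ p₀ B₀ ω) (growth m est r₀ p₀ B₀ ω) :=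
  hloc τ hτ _ _ _ _ (fun _ hs => trajectory_rate_eq hs.le) fun _ hs => trajectory_growth_eq hs

lemma rate_succ (hloc : est.IsLocal) (t : ℕ) : rate m est r₀ p₀ B₀ ω (t + 1) =
    if (ω t).2.2.1 then (ω t).2.2.2 else stoppedRate m est r₀ p₀ B₀ (t + 1) ω := by
  have hstep : rate m est r₀ p₀ B₀ ω (t + 1) = if (ω t).2.2.1 then (ω t).2.2.2 else
      est (t + 1) (trajectory m est r₀ p₀ B₀ ω t).rate
        (trajectory m est r₀ p₀ B₀ ω (t + 1)).growth := by
    simp [rate, trajectory, step]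
  rw [hstep, stoppedRate]
  congr 1
  refine hloc _ t.succ_ne_zero _ _ _ _ (fun s hs => ?_) fun _ _ => rfl
  rw [trajectory_rate_eq (Nat.lt_succ_iff.1 hs), trajectory_rate_eq hs.le]

variable (hest : ∀ n, Measurable fun p : (ℕ → ℝ) × (ℕ → ℝ) => est n p.1 p.2)
include hest

lemma measurable_trajectory (hp : 0 < p₀) (t : ℕ) : Measurable[slotFiltration t] fun ω =>
    ((trajectory m est r₀ p₀ B₀ ω t).debt, (trajectory m est r₀ p₀ B₀ ω t).rate,
      (trajectory m est r₀ p₀ B₀ ω t).growth) := by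
  induction t with
  | zero =>
    simp only [trajectory]
    exact measurable_const
  | succ t ih =>
    have ih' := ih.mono (slotFiltration.mono t.le_succ) le_rfl
    have hdebt := measurable_fst.comp ih'
    have hrate := measurable_fst.comp (measurable_snd.comp ih')
    have hupdate (s : ℕ) : Measurable fun p : (ℕ → ℝ) × ℝ => Function.update p.1 s p.2 :=
      measurable_update'.comp (by fun_prop)
    have hdebt' : Measurable[slotFiltration (t + 1)] fun ω =>
        (trajectory m est r₀ p₀ B₀ ω (t + 1)).debt := by
      simp only [trajectory_debt_succ hp]
      exact hdebt.mul (measurable_const.add (((((measurable_pi_apply t).comp hrate).const_sub _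
        ).const_mul _).add (measurable_noise t)))
    have hgrowth' : Measurable[slotFiltration (t + 1)] fun ω =>
        (trajectory m est r₀ p₀ B₀ ω (t + 1)).growth :=
      (hupdate t).comp ((measurable_snd.comp (measurable_snd.comp ih')).prodMk
        ((hdebt'.sub hdebt).div hdebt))
    have hcontrol := measurable_snd.comp (measurable_snd.comp (measurable_slot t))
    exact hdebt'.prodMk (((hupdate (t + 1)).comp (hrate.prodMk (Measurable.ite
      ((measurable_fst.comp hcontrol) (measurableSet_singleton true))
      (measurable_snd.comp hcontrol) ((hest (t + 1)).comp (hrate.prodMk hgrowth'))))).prodMk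
      hgrowth')

lemma measurable_rate (hp : 0 < p₀) (t : ℕ) :
    Measurable[slotFiltration t] fun ω => rate m est r₀ p₀ B₀ ω t :=
  (measurable_pi_apply t).comp
    (measurable_fst.comp (measurable_snd.comp (measurable_trajectory hest hp t)))

lemma ae_debt_ne_zero (K : Controller) (hp : 0 < p₀) (hB : B₀ ≠ 0) :
    ∀ᵐ ω ∂(poolLaw m K), ∀ t, (trajectory m est r₀ p₀ B₀ ω t).debt ≠ 0 := by
  have hnoise : ∀ᵐ ω ∂(poolLaw m K), ∀ t,
      noise t ω ≠ -1 - m.η * (m.equilibriumRate - rate m est r₀ p₀ B₀ ω t) := by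
    refine ae_all_iff.2 fun t => ?_
    have hF := (((measurable_rate (m := m) (B₀ := B₀) (r₀ := r₀) hest hp t).const_sub
      m.equilibriumRate).const_mul m.η).const_sub (-1)
    have : NullSingletonClass ((poolLaw m K).map (noise t)) := by
      rw [(hasLaw_noise m K t).map_eq]
      exact nullSingletonClass_gaussianReal (pow_pos m.ζ_pos 2).ne'
    exact ae_ne_of_indepFun (hF.mono (slotFiltration.le t) le_rfl).aemeasurable
      (hasLaw_noise m K t).aemeasurable ((isSubgaussianNoise m K).indepFun hF)
  filter_upwards [hnoise] with ω hω t
  induction t with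
  | zero => exact hB
  | succ t ih =>
    rw [trajectory_debt_succ hp]
    exact mul_ne_zero ih fun h => hω t (by linarith)

lemma ae_growth_eq (K : Controller) (hp : 0 < p₀) (hB : B₀ ≠ 0) : ∀ᵐ ω ∂(poolLaw m K), ∀ t,
    growth m est r₀ p₀ B₀ ω t
      = m.η * (m.equilibriumRate - rate m est r₀ p₀ B₀ ω t) + noise t ω := by
  filter_upwards [ae_debt_ne_zero hest K hp hB] with ω hω t
  exact growth_eq hp (hω t)

end Trajectory

section KnownElasticity

variable {m : Market} {r₀ p₀ B₀ : ℝ} {τ : ℕ}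

lemma knownElasticityEstimator_isLocal (η : ℝ) : (knownElasticityEstimator η).IsLocal := by
  intro n _ r r' y y' hr hy
  simp only [knownElasticityEstimator]
  rw [Finset.sum_congr rfl fun s hs => by
    rw [hr s (Finset.mem_range.1 hs), hy s (Finset.mem_range.1 hs)]]

lemma knownElasticityEstimator_eq {η ρ : ℝ} {r y ε : ℕ → ℝ} (hη : η ≠ 0) (hτ : τ ≠ 0)
    (hy : ∀ s, y s = η * (ρ - r s) + ε s) :
    knownElasticityEstimator η τ r y = ρ + empMean τ ε / η := by
  have hterm (s : ℕ) : y s + η * r s = η * ρ + ε s := by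
    rw [hy s]
    ring
  simp only [knownElasticityEstimator, hterm, empMean_apply, Finset.sum_add_distrib,
    Finset.sum_const, Finset.card_range, nsmul_eq_mul]
  field_simp

lemma ae_stoppedRate_knownElasticityEstimator_eq (K : Controller) (hη : m.η ≠ 0) (hp : 0 < p₀)
    (hB : B₀ ≠ 0) (hτ : τ ≠ 0) :
    stoppedRate m (knownElasticityEstimator m.η) r₀ p₀ B₀ τ =ᵐ[poolLaw m K]
      fun ω => m.equilibriumRate + empMean τ (noise · ω) / m.η := by
  have hest (n : ℕ) : Measurable fun p : (ℕ → ℝ) × (ℕ → ℝ) =>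
      knownElasticityEstimator m.η n p.1 p.2 := by
    unfold knownElasticityEstimator
    fun_prop
  filter_upwards [ae_growth_eq hest K hp hB] with ω hω
  rw [stoppedRate_eq (knownElasticityEstimator_isLocal m.η) hτ]
  exact knownElasticityEstimator_eq hη hτ hω

theorem integrable_stoppedRate_knownElasticityEstimator (K : Controller) (hη : m.η ≠ 0)
    (hp : 0 < p₀) (hB : B₀ ≠ 0) (hτ : τ ≠ 0) :
    Integrable (stoppedRate m (knownElasticityEstimator m.η) r₀ p₀ B₀ τ) (poolLaw m K) :=
  ((integrable_const _).add ((integrable_empMean_noise m K τ).div_const _)).congr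
    (ae_stoppedRate_knownElasticityEstimator_eq K hη hp hB hτ).symm

theorem integral_stoppedRate_knownElasticityEstimator (K : Controller) (hη : m.η ≠ 0)
    (hp : 0 < p₀) (hB : B₀ ≠ 0) (hτ : τ ≠ 0) :
    ∫ ω, stoppedRate m (knownElasticityEstimator m.η) r₀ p₀ B₀ τ ω ∂(poolLaw m K)
      = m.equilibriumRate := by
  rw [integral_congr_ae (ae_stoppedRate_knownElasticityEstimator_eq K hη hp hB hτ),
    integral_add (integrable_const _) ((integrable_empMean_noise m K τ).div_const _),
    integral_div, integral_empMean_noise]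
  simp

end KnownElasticity

end LendingPool

lemma tendsto_empMean_of_succ {f : ℕ → ℝ} {l : ℝ}
    (h : Tendsto (fun n => empMean n fun s => f (s + 1)) atTop (𝓝 l)) :
    Tendsto (fun n => empMean n f) atTop (𝓝 l) := by
  have hsplit (n : ℕ) : empMean (n + 1) f
      = n / ((n : ℝ) + 1) * empMean n (fun s => f (s + 1)) + f 0 * (1 / ((n : ℝ) + 1)) := by
    rcases eq_or_ne n 0 with rfl | hn
    · simp [empMean_apply]
    · rw [empMean_apply, empMean_apply, Finset.sum_range_succ', Nat.cast_succ]
      field_simp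
  refine (tendsto_add_atTop_iff_nat 1).1 ?_
  simpa [hsplit] using ((tendsto_natCast_div_add_atTop (1 : ℝ)).mul h).add
    (tendsto_one_div_add_atTop_nhds_zero_nat.const_mul (f 0))

lemma variance_pos_of_ae_ne {Ω : Type*} {mΩ : MeasurableSpace Ω} {P : Measure Ω}
    [IsProbabilityMeasure P] {X : Ω → ℝ} (hX : MemLp X 2 P)
    (hne : ∀ c, ∀ᵐ ω ∂P, X ω ≠ c) : 0 < Var[X; P] := by
  refine (variance_nonneg X P).lt_of_ne' fun h => ?_
  obtain ⟨ω, heq, hne⟩ := ((ae_eq_integral_of_variance_eq_zero hX h).and (hne _)).exists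
  exact hne heq

lemma integral_sq_gaussianReal (v : ℝ≥0) : ∫ x, x ^ 2 ∂(gaussianReal 0 v) = v := by
  have h := variance_eq_sub (memLp_id_gaussianReal (μ := 0) (v := v) 2)
  simpa using h.symm

namespace LendingPool

section Exploration

variable (m : Market) (K : Controller)

lemma ae_tendsto_empMean_slot {f : Slot → ℝ} (hf : Measurable f)
    (hint : Integrable f (slotLaw m K)) : ∀ᵐ ω ∂(poolLaw m K),
      Tendsto (fun n => empMean n fun s => f (ω s)) atTop (𝓝 (∫ x, f x ∂(slotLaw m K))) := by
  have hmp := measurePreserving_slot m K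
  have hindep := (iIndepFun_slot m K).comp (fun _ => f) fun _ => hf
  have hident (t : ℕ) : IdentDistrib (fun ω : ℕ → Slot => ω t) (fun ω => ω 0) (poolLaw m K)
      (poolLaw m K) := ⟨(hmp t).aemeasurable, (hmp 0).aemeasurable,
        (hmp t).map_eq.trans (hmp 0).map_eq.symm⟩
  have hmean : ∫ ω, f (ω 0) ∂(poolLaw m K) = ∫ x, f x ∂(slotLaw m K) :=
    (hmp 0).hasLaw.integral_comp hf.aestronglyMeasurable
  rw [← hmean]
  simp only [empMean_apply, inv_mul_eq_div]
  exact strong_law_ae_real (fun t (ω : ℕ → Slot) => f (ω t))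
    ((hmp 0).integrable_comp_of_integrable hint) (fun _ _ hst => hindep.indepFun hst)
    fun t => (hident t).comp hf

lemma measurePreserving_slotRate :
    MeasurePreserving (fun x : Slot => x.2.2.2) (slotLaw m K) (explorationLaw K) :=
  measurePreserving_snd.comp (measurePreserving_snd.comp measurePreserving_snd)

/-- Indicator of exploration. -/
def explores (x : Slot) : ℝ := if x.2.2.1 then 1 else 0

lemma explores_eq_zero_or_one (x : Slot) : explores x = 0 ∨ explores x = 1 := by
  unfold explores
  split_ifs <;> simp

lemma measurable_explores : Measurable explores :=
  Measurable.ite ((measurable_fst.comp (measurable_snd.comp measurable_snd))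
    (measurableSet_singleton true)) measurable_const measurable_const

lemma memLp_explorationLaw {g : ℝ → ℝ} (hg : Continuous g) (p : ℝ≥0∞) :
    MemLp g p (explorationLaw K) := by
  obtain ⟨C, hC⟩ := (isCompact_Icc (a := K.rMin) (b := K.rMax)).exists_bound_of_continuousOn
    hg.continuousOn
  exact MemLp.of_bound hg.aestronglyMeasurable C ((ae_cond_mem measurableSet_Icc).mono hC)

lemma memLp_explores_mul {g : ℝ → ℝ} (hg : Continuous g) (p : ℝ≥0∞) :
    MemLp (fun x => explores x * g x.2.2.2) p (slotLaw m K) := by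
  have hmp := measurePreserving_slotRate m K
  refine ((memLp_explorationLaw K hg p).comp_measurePreserving hmp).mono
    (measurable_explores.mul (hg.measurable.comp hmp.measurable)).aestronglyMeasurable
    (ae_of_all _ fun x => ?_)
  rcases explores_eq_zero_or_one x with h | h <;> simp [h]

lemma integral_explores_mul {g : ℝ → ℝ} (hg : Measurable g) :
    ∫ x, explores x * g x.2.2.2 ∂(slotLaw m K) = K.ν * ∫ w, g w ∂(explorationLaw K) := by
  have hmp : MeasurePreserving (fun x : Slot => x.2.2) (slotLaw m K)
      ((bernoulliMeasure true false K.ν).prod (explorationLaw K)) :=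
    measurePreserving_snd.comp measurePreserving_snd
  have hcoin : Measurable fun b : Bool => if b then (1 : ℝ) else 0 := by fun_prop
  calc ∫ x, explores x * g x.2.2.2 ∂(slotLaw m K)
      = ∫ y : Bool × ℝ, (if y.1 then 1 else 0) * g y.2
          ∂((bernoulliMeasure true false K.ν).prod (explorationLaw K)) :=
        hmp.hasLaw.integral_comp ((hcoin.comp measurable_fst).mul
          (hg.comp measurable_snd)).aestronglyMeasurable
    _ = K.ν * ∫ w, g w ∂(explorationLaw K) := by
        rw [integral_prod_mul (fun b : Bool => if b then (1 : ℝ) else 0)]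
        simp [integral_bernoulliMeasure]

/-- The moments of the distance of the exploratory rates from the equilibrium rate, where a slot
without exploration counts as `0`. -/
def explorationMoment (k : ℕ) : ℝ :=
  K.ν * ∫ w, (w - m.equilibriumRate) ^ k ∂(explorationLaw K)

lemma integral_explores_mul_pow (k : ℕ) :
    ∫ x, explores x * (x.2.2.2 - m.equilibriumRate) ^ k ∂(slotLaw m K)
      = explorationMoment m K k :=
  integral_explores_mul m K ((measurable_id.sub_const _).pow_const k)

lemma explorationMoment_zero : explorationMoment m K 0 = K.ν := by
  simp [explorationMoment]

lemma explorationMoment_one_sq_lt :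
    explorationMoment m K 1 ^ 2 < K.ν * explorationMoment m K 2 := by
  have hν : (0 : ℝ) < K.ν := K.ν_pos
  have hLp : MemLp (fun w => w - m.equilibriumRate) 2 (explorationLaw K) :=
    memLp_explorationLaw K (by fun_prop) 2
  have hvar := variance_pos_of_ae_ne hLp fun c => by
    filter_upwards [cond_absolutelyContinuous.ae_le (Measure.ae_ne volume (m.equilibriumRate + c))]
      with w hw h
    exact hw (by linarith)
  rw [variance_eq_sub hLp] at hvar
  simp only [explorationMoment, pow_one]
  simp only [Pi.pow_apply] at hvar
  nlinarith [mul_pos (mul_pos hν hν) hvar]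

lemma explorationMoment_two_pos : 0 < explorationMoment m K 2 :=
  pos_of_mul_pos_right ((sq_nonneg _).trans_lt (explorationMoment_one_sq_lt m K)) K.ν.2.1

lemma explorationMoment_one_sq_lt_two : explorationMoment m K 1 ^ 2 < explorationMoment m K 2 :=
  (explorationMoment_one_sq_lt m K).trans_le
    (mul_le_of_le_one_left (explorationMoment_two_pos m K).le K.ν.2.2)

end Exploration

section Regression

/-- Indicator that the rate of slot `s` is exploratory. -/
def explored (ω : ℕ → Slot) : ℕ → ℝ
  | 0 => 0
  | s + 1 => explores (ω s)

variable {m : Market} {r₀ p₀ B₀ : ℝ}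

lemma explored_mul_rate_sub_pow {est : Estimator} (hloc : est.IsLocal) (ω : ℕ → Slot) (k s : ℕ) :
    explored ω (s + 1) * (rate m est r₀ p₀ B₀ ω (s + 1) - m.equilibriumRate) ^ k
      = explores (ω s) * ((ω s).2.2.2 - m.equilibriumRate) ^ k := by
  rw [rate_succ hloc, explored, explores]
  split_ifs <;> simp

lemma rate_eq_stoppedRate {est : Estimator} (hloc : est.IsLocal) {ω : ℕ → Slot} {s : ℕ}
    (hs : s ≠ 0) (h : explored ω s = 0) :
    rate m est r₀ p₀ B₀ ω s = stoppedRate m est r₀ p₀ B₀ s ω := by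
  obtain ⟨s, rfl⟩ := Nat.exists_eq_succ_of_ne_zero hs
  rw [rate_succ hloc, if_neg]
  simpa [explored, explores] using h

lemma ae_tendsto_empMean_noise_pow (m : Market) (K : Controller) (k : ℕ) :
    ∀ᵐ ω ∂(poolLaw m K), Tendsto (fun n => empMean n fun s => noise s ω ^ k) atTop
      (𝓝 (∫ x, x ^ k ∂(gaussianReal 0 (m.ζ ^ 2)))) := by
  have hmp := measurePreserving_slotNoise m K
  rw [← hmp.hasLaw.integral_comp (by fun_prop)]
  exact ae_tendsto_empMean_slot m K (hmp.measurable.pow_const k)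
    (hmp.integrable_comp_of_integrable ((integrable_norm_iff (by fun_prop)).1
      (by simpa only [norm_pow, id] using (memLp_id_gaussianReal k).integrable_norm_pow')))

lemma ae_tendsto_empMean_explored_pow (m : Market) (K : Controller) {est : Estimator}
    (hloc : est.IsLocal) (k : ℕ) : ∀ᵐ ω ∂(poolLaw m K),
      Tendsto (fun n => empMean n fun s =>
        explored ω s * (rate m est r₀ p₀ B₀ ω s - m.equilibriumRate) ^ k)
        atTop (𝓝 (explorationMoment m K k)) := by
  have hg : Continuous fun w : ℝ => (w - m.equilibriumRate) ^ k := by fun_prop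
  have hslln := ae_tendsto_empMean_slot m K (f := fun x =>
    explores x * (x.2.2.2 - m.equilibriumRate) ^ k)
    (measurable_explores.mul (hg.measurable.comp (measurePreserving_slotRate m K).measurable))
    ((memLp_explores_mul m K hg 1).integrable le_rfl)
  filter_upwards [hslln] with ω hω
  rw [integral_explores_mul_pow] at hω
  exact tendsto_empMean_of_succ (by simpa only [explored_mul_rate_sub_pow hloc] using hω)

variable (m r₀ p₀ B₀) in
/-- The signed distance from the equilibrium rate of the rate that the least-squares controller
sets in slot `s`. -/
def rateError (ω : ℕ → Slot) (s : ℕ) : ℝ := rate m lsEstimator r₀ p₀ B₀ ω s - m.equilibriumRate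

variable (m r₀ p₀ B₀) in
/-- The signed distance from the equilibrium rate of the least-squares estimate from `n` samples. -/
def estimateError (ω : ℕ → Slot) (n : ℕ) : ℝ :=
  stoppedRate m lsEstimator r₀ p₀ B₀ n ω - m.equilibriumRate

lemma measurable_rateError (hp : 0 < p₀) (s : ℕ) :
    Measurable[slotFiltration s] fun ω => rateError m r₀ p₀ B₀ ω s :=
  (measurable_rate measurable_lsEstimator hp s).sub_const _

theorem ae_adaptiveRegression (K : Controller) (hη : m.η ≠ 0) (hp : 0 < p₀) (hB : B₀ ≠ 0) :
    ∀ᵐ ω ∂(poolLaw m K), AdaptiveRegression m.η K.ν (explorationMoment m K 1)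
      (explorationMoment m K 2) (m.ζ ^ 2)
      (rateError m r₀ p₀ B₀ ω) (noise · ω) (explored ω) (estimateError m r₀ p₀ B₀ ω) := by
  have htransform := (isSubgaussianNoise m K).ae_eventually_abs_empMean_le
    fun s => measurable_rateError (m := m) (r₀ := r₀) (B₀ := B₀) hp s
  filter_upwards [ae_growth_eq (r₀ := r₀) measurable_lsEstimator K hp hB, htransform,
    ae_tendsto_empMean_noise_pow m K 1, ae_tendsto_empMean_noise_pow m K 2,
    ae_tendsto_empMean_explored_pow (r₀ := r₀) (p₀ := p₀) (B₀ := B₀) m K lsEstimator_isLocal 0,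
    ae_tendsto_empMean_explored_pow m K lsEstimator_isLocal 1,
    ae_tendsto_empMean_explored_pow m K lsEstimator_isLocal 2]
    with ω hgrowth htransform hnoise hnoise_sq hfrequency hmean hsq
  refine {
    slope_ne_zero := hη
    frequency_pos := K.ν_pos
    sq_lt := explorationMoment_one_sq_lt m K
    indicator := ?_
    exploited := fun s hs h => by
      rw [rateError, estimateError, rate_eq_stoppedRate lsEstimator_isLocal hs h]
    estimate_eq := fun n hx hxε => ?_
    tendsto_noise := by simpa using hnoise
    tendsto_noise_sq := by rwa [integral_sq_gaussianReal, NNReal.coe_pow] at hnoise_sq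
    tendsto_indicator := by simpa [explorationMoment_zero] using hfrequency
    tendsto_explored := by
      simp only [pow_one] at hmean
      exact hmean
    tendsto_explored_sq := hsq
    eventually_transform_le := htransform }
  · rintro (_ | s)
    exacts [Or.inl rfl, explores_eq_zero_or_one _]
  · have hn : n ≠ 0 := by
      rintro rfl
      simp [empCov, empMean_apply] at hx
    rw [estimateError, stoppedRate_eq lsEstimator_isLocal hn]
    exact lsEstimator_sub_eq hx hxε (fun s => (sub_add_cancel _ _).symm) hgrowth

end Regression

end LendingPool

section Independence

variable {Ω ι κ E : Type*} {mΩ : MeasurableSpace Ω} {mE : MeasurableSpace E} {P : Measure Ω}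

lemma iIndepFun_curry {X : ι → κ → Ω → E} (hX : ∀ i j, Measurable (X i j))
    (h : iIndepFun (fun (p : ι × κ) => X p.1 p.2) P) : iIndepFun (fun i ω j => X i j ω) P := by
  have := h.isProbabilityMeasure
  have hprob i j : IsProbabilityMeasure (P.map (X i j)) :=
    Measure.isProbabilityMeasure_map (hX i j).aemeasurable
  have hrow (i : ι) : P.map (fun ω j => X i j ω) = Measure.infinitePi fun j => P.map (X i j) :=
    (h.precomp (Prod.mk_right_injective i)).map_fun_eq_infinitePi_map (hX i)
  have hall := h.map_fun_eq_infinitePi_map fun p : ι × κ => hX p.1 p.2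
  rw [iIndepFun_iff_map_fun_eq_infinitePi_map fun i => measurable_pi_lambda _ (hX i)]
  simp only [hrow]
  rw [← Measure.infinitePi_map_curry (fun i j => P.map (X i j)), ← hall,
    Measure.map_map (MeasurableEquiv.measurable _) (by fun_prop)]
  rfl

lemma iIndepFun_bool_cond [IsProbabilityMeasure P] {X Y : Ω → E} (h : IndepFun X Y P) :
    iIndepFun (fun (b : Bool) => bif b then Y else X) P := by
  rw [iIndepFun_iff_measure_inter_preimage_eq_mul]
  intro S
  obtain rfl | rfl | rfl | rfl : S = ∅ ∨ S = {false} ∨ S = {true} ∨ S = {false, true} := by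
    decide +revert
  · simp
  · simp
  · simp
  · intro A hA
    rw [Finset.set_biInter_insert, Finset.set_biInter_singleton,
      Finset.prod_pair Bool.false_ne_true]
    exact h.measure_inter_preimage_eq_mul _ _ (hA false (by simp)) (hA true (by simp))

lemma iIndepFun_mul_succ {X Y : ℕ → Ω → ℝ} (hX : ∀ n, Measurable (X n))
    (hY : ∀ n, Measurable (Y n)) (hpair : iIndepFun (fun n ω => (X n ω, Y n ω)) P)
    (hXY : ∀ n, IndepFun (X n) (Y n) P) : iIndepFun (fun n ω => X n ω * Y (n + 1) ω) P := by
  have := hpair.isProbabilityMeasure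
  let Z (n : ℕ) (b : Bool) : Ω → ℝ := bif b then Y n else X n
  have hZ n b : Measurable (Z n b) := by cases b <;> simp [Z, hX, hY]
  have hrows : iIndepFun (fun n ω b => Z n b ω) P := by
    have hsplit : Measurable fun (p : ℝ × ℝ) (b : Bool) => bif b then p.2 else p.1 :=
      measurable_pi_lambda _ fun b => by cases b <;> simp [measurable_fst, measurable_snd]
    convert hpair.comp (fun _ p (b : Bool) => bif b then p.2 else p.1) fun _ => hsplit using 1
    ext n ω b
    cases b <;> rfl
  have hshift : Function.Injective fun p : ℕ × Bool => (p.1 + p.2.toNat, p.2) := by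
    rintro ⟨n, b⟩ ⟨n', b'⟩ h
    grind
  have hshifted := iIndepFun_curry (fun n (b : Bool) => hZ (n + b.toNat) b)
    ((iIndepFun_uncurry' hZ hrows fun n => iIndepFun_bool_cond (hXY n)).precomp hshift)
  exact hshifted.comp (fun _ f => f false * f true)
    fun _ => (measurable_pi_apply false).mul (measurable_pi_apply true)

end Independence

lemma indepFun_comp_measurePreserving {Ω Ω' E F : Type*} {mΩ : MeasurableSpace Ω}
    {mΩ' : MeasurableSpace Ω'} {mE : MeasurableSpace E} {mF : MeasurableSpace F} {P : Measure Ω}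
    {P' : Measure Ω'} {T : Ω → Ω'} {X : Ω' → E} {Y : Ω' → F} (h : IndepFun X Y P')
    (hX : Measurable X) (hY : Measurable Y) (hT : MeasurePreserving T P P') :
    IndepFun (fun ω => X (T ω)) (fun ω => Y (T ω)) P := by
  rw [indepFun_iff_measure_inter_preimage_eq_mul] at h ⊢
  intro A B hA hB
  have hmeasure {S : Set Ω'} (hS : MeasurableSet S) : P (T ⁻¹' S) = P' S :=
    hT.measure_preimage hS.nullMeasurableSet
  have := h A B hA hB
  rwa [← hmeasure ((hX hA).inter (hY hB)), ← hmeasure (hX hA), ← hmeasure (hY hB)] at this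

section Slutsky

variable {Ω Ω' : Type*} {mΩ : MeasurableSpace Ω} {mΩ' : MeasurableSpace Ω'} {P : Measure Ω}
  {P' : Measure Ω'} [IsProbabilityMeasure P] [IsProbabilityMeasure P']
  {X Y : ℕ → Ω → ℝ} {Z : Ω' → ℝ}

lemma eventually_lt_measureReal_preimage_of_isOpen
    (h : TendstoInDistribution X atTop Z (fun _ => P) P') {U : Set ℝ} (hU : IsOpen U) {a : ℝ}
    (ha : a < (P'.map Z).real U) : ∀ᶠ n in atTop, a < P.real (X n ⁻¹' U) := by
  have : IsProbabilityMeasure (P'.map Z) := Measure.isProbabilityMeasure_map h.aemeasurable_limit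
  rcases lt_or_ge a 0 with ha0 | ha0
  · exact Eventually.of_forall fun n => ha0.trans_le measureReal_nonneg
  have hlim := ProbabilityMeasure.le_liminf_measure_open_of_tendsto h.tendsto hU
  have hlt : ENNReal.ofReal a < (P'.map Z) U :=
    (ENNReal.ofReal_lt_iff_lt_toReal ha0 (measure_ne_top _ _)).2 ha
  filter_upwards [eventually_lt_of_lt_liminf (hlt.trans_le hlim)] with n hn
  rw [ProbabilityMeasure.coe_mk, Measure.map_apply_of_aemeasurable (h.forall_aemeasurable n)
    hU.measurableSet] at hn
  exact (ENNReal.ofReal_lt_iff_lt_toReal ha0 (measure_ne_top _ _)).1 hn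

lemma tendstoInMeasure_zero_of_tendstoInDistribution
    (h : TendstoInDistribution X atTop (fun _ => (0 : ℝ)) (fun _ => P) P') :
    TendstoInMeasure P X atTop 0 := by
  rw [tendstoInMeasure_iff_measureReal_norm]
  intro κ hκ
  have hball : (P'.map fun _ => (0 : ℝ)).real (Metric.ball 0 κ) = 1 := by
    simp [Measure.map_const, measureReal_def,
      Measure.dirac_apply' _ Metric.isOpen_ball.measurableSet, hκ]
  have hcompl (n : ℕ) : P.real {ω | κ ≤ ‖X n ω - (0 : Ω → ℝ) ω‖}
      = 1 - P.real (X n ⁻¹' Metric.ball 0 κ) := by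
    rw [← probReal_compl_eq_one_sub₀ ((h.forall_aemeasurable n).nullMeasurableSet_preimage
      Metric.isOpen_ball.measurableSet)]
    congr 1
    ext ω
    simp
  refine Metric.tendsto_nhds.2 fun ρ hρ => ?_
  filter_upwards [eventually_lt_measureReal_preimage_of_isOpen h Metric.isOpen_ball
    (hball ▸ sub_lt_self 1 hρ)] with n hn
  rw [hcompl, Real.dist_0_eq_abs, abs_of_nonneg (sub_nonneg.2 measureReal_le_one)]
  linarith

lemma tendstoInMeasure_mul_zero (hX : TendstoInDistribution X atTop Z (fun _ => P) P')
    (hY : ∀ n, AEMeasurable (Y n) P) (hY_zero : TendstoInMeasure P Y atTop 0) :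
    TendstoInMeasure P (fun n ω => Y n ω * X n ω) atTop 0 := by
  have := hX.continuous_comp_prodMk_of_tendstoInMeasure_const (g := fun p : ℝ × ℝ => p.2 * p.1)
    (c := 0) (by fun_prop) hY_zero hY
  simp only [zero_mul] at this
  exact tendstoInMeasure_zero_of_tendstoInDistribution this

lemma tendstoInMeasure_add_zero (hX : TendstoInMeasure P X atTop 0)
    (hY : TendstoInMeasure P Y atTop 0) (hXm : ∀ n, AEMeasurable (X n) P)
    (hYm : ∀ n, AEMeasurable (Y n) P) : TendstoInMeasure P (X + Y) atTop 0 := by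
  have := (hX.tendstoInDistribution hXm).add_of_tendstoInMeasure_const (c := 0) hY hYm
  simp only [Pi.zero_apply, add_zero] at this
  exact tendstoInMeasure_zero_of_tendstoInDistribution this

lemma tendstoInMeasure_zero_of_ae_eventually_eq (hX : TendstoInMeasure P X atTop 0)
    (hXm : ∀ n, AEMeasurable (X n) P) (hYm : ∀ n, AEMeasurable (Y n) P)
    (h : ∀ᵐ ω ∂P, ∀ᶠ n in atTop, Y n ω = X n ω) : TendstoInMeasure P Y atTop 0 := by
  have hsub : TendstoInMeasure P (Y - X) atTop 0 := by
    refine tendstoInMeasure_of_tendsto_ae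
      (fun n => ((hYm n).sub (hXm n)).aestronglyMeasurable) ?_
    filter_upwards [h] with ω hω
    exact tendsto_const_nhds.congr' (hω.mono fun n hn => (sub_eq_zero.2 hn).symm)
  simpa only [sub_add_cancel] using
    tendstoInMeasure_add_zero hsub hX (fun n => (hYm n).sub (hXm n)) hXm

lemma tendstoInDistribution_sqrt_mul_empMean_of_succ {f : ℕ → Ω → ℝ} (hf : ∀ s, Measurable (f s))
    (h : TendstoInDistribution (fun (n : ℕ) ω => √n * empMean n fun s => f (s + 1) ω) atTop Z
      (fun _ => P) P') :
    TendstoInDistribution (fun (n : ℕ) ω => √n * empMean n (f · ω)) atTop Z (fun _ => P) P' := by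
  have hmeas (n : ℕ) : AEMeasurable (fun ω => √n * empMean n (f · ω)) P :=
    ((measurable_empMean n).comp (measurable_pi_lambda _ hf)).aemeasurable.const_mul _
  have hsqrt : Tendsto (fun n : ℕ => √(n / ((n : ℝ) + 1)) - 1) atTop (𝓝 0) := by
    simpa using ((tendsto_natCast_div_add_atTop (1 : ℝ)).sqrt).sub_const 1
  have hfirst : TendstoInMeasure P (fun (n : ℕ) ω => √(1 / ((n : ℝ) + 1)) * f 0 ω) atTop 0 := by
    refine tendstoInMeasure_of_tendsto_ae (fun n => ((hf 0).const_mul _).aestronglyMeasurable)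
      (ae_of_all _ fun ω => ?_)
    simpa using (tendsto_one_div_add_atTop_nhds_zero_nat (𝕜 := ℝ)).sqrt.mul_const (f 0 ω)
  have hsplit (n : ℕ) (ω : Ω) : √(n + 1 : ℕ) * empMean (n + 1) (f · ω)
      - √n * empMean n (fun s => f (s + 1) ω)
      = (√(n / ((n : ℝ) + 1)) - 1) * (√n * empMean n fun s => f (s + 1) ω)
        + √(1 / ((n : ℝ) + 1)) * f 0 ω := by
    rcases eq_or_ne n 0 with rfl | hn
    · simp [empMean_apply]
    have : 0 < √(n : ℝ) := Real.sqrt_pos.2 (Nat.cast_pos.2 (Nat.pos_of_ne_zero hn))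
    have : 0 < √((n + 1 : ℕ) : ℝ) := Real.sqrt_pos.2 (Nat.cast_pos.2 n.succ_pos)
    have hinv (k : ℕ) : (k : ℝ)⁻¹ = (√k ^ 2)⁻¹ := by rw [Real.sq_sqrt k.cast_nonneg]
    rw [empMean_apply, empMean_apply, Finset.sum_range_succ', ← Nat.cast_succ,
      Real.sqrt_div n.cast_nonneg, Real.sqrt_div zero_le_one, Real.sqrt_one, hinv, hinv]
    field_simp
    ring
  have hsub : TendstoInMeasure P (fun (n : ℕ) ω => √(n + 1 : ℕ) * empMean (n + 1) (f · ω)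
      - √n * empMean n fun s => f (s + 1) ω) atTop 0 := by
    simp only [hsplit]
    exact tendstoInMeasure_add_zero
      (tendstoInMeasure_mul_zero h (fun n => aemeasurable_const)
        (tendstoInMeasure_of_tendsto_ae (fun n => aestronglyMeasurable_const)
          (ae_of_all _ fun _ => hsqrt)))
      hfirst (fun n => (h.forall_aemeasurable n).const_mul _)
      fun n => ((hf 0).const_mul _).aemeasurable
  have hsucc := tendstoInDistribution_of_tendstoInMeasure_sub _ Z h hsub fun n => hmeas (n + 1)
  exact ⟨hmeas, h.aemeasurable_limit, (tendsto_add_atTop_iff_nat 1).1 hsucc.tendsto⟩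

end Slutsky

lemma memLp_two_mul_of_indepFun {Ω : Type*} {mΩ : MeasurableSpace Ω} {P : Measure Ω}
    {F G : Ω → ℝ} (h : IndepFun F G P) (hF : MemLp F 2 P) (hG : MemLp G 2 P) :
    MemLp (fun ω => F ω * G ω) 2 P := by
  refine (memLp_two_iff_integrable_sq (hF.1.mul hG.1)).2 ?_
  have := (h.comp (measurable_id.pow_const 2) (measurable_id.pow_const 2)).integrable_mul
    hF.integrable_sq hG.integrable_sq
  simpa only [Pi.mul_def, Function.comp_apply, id, mul_pow] using this

section CentralLimit

variable {Ω Ω' : Type*} {mΩ : MeasurableSpace Ω} {mΩ' : MeasurableSpace Ω'} {P : Measure Ω}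
  {P' : Measure Ω'} [IsProbabilityMeasure P] [IsProbabilityMeasure P']
  {X Y : ℕ → Ω → ℝ} {Z : Ω' → ℝ}

lemma tendstoInDistribution_sqrt_mul_empMean_mul_succ (hX : ∀ n, Measurable (X n))
    (hY : ∀ n, Measurable (Y n)) (hpair : iIndepFun (fun n ω => (X n ω, Y n ω)) P)
    (hXY : ∀ n, IndepFun (X n) (Y n) P) (hX_ident : ∀ n, IdentDistrib (X n) (X 0) P P)
    (hY_ident : ∀ n, IdentDistrib (Y n) (Y 0) P P) (hX_memLp : MemLp (X 0) 2 P)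
    (hY_memLp : MemLp (Y 0) 2 P) (hY_mean : ∫ ω, Y 0 ω ∂P = 0)
    (hZ : HasLaw Z
      (gaussianReal 0 ((∫ ω, X 0 ω ^ 2 ∂P) * ∫ ω, Y 0 ω ^ 2 ∂P).toNNReal) P') :
    TendstoInDistribution (fun (n : ℕ) ω => √n * empMean n fun s => X s ω * Y (s + 1) ω) atTop Z
      (fun _ => P) P' := by
  have hsucc (n : ℕ) : IndepFun (X n) (Y (n + 1)) P :=
    (hpair.indepFun n.succ_ne_self.symm).comp measurable_fst measurable_snd
  have hmean : ∫ ω, X 0 ω * Y 1 ω ∂P = 0 := by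
    rw [(hsucc 0).integral_fun_mul_eq_mul_integral (hX 0).aestronglyMeasurable
      (hY 1).aestronglyMeasurable, (hY_ident 1).integral_eq, hY_mean, mul_zero]
  have hvar : Var[fun ω => X 0 ω * Y 1 ω; P] = (∫ ω, X 0 ω ^ 2 ∂P) * ∫ ω, Y 0 ω ^ 2 ∂P := by
    rw [variance_of_integral_eq_zero (by fun_prop) hmean]
    simp only [mul_pow]
    rw [(hsucc 0).integral_fun_comp_mul_comp (f := (· ^ 2)) (g := (· ^ 2)) (hX 0).aemeasurable
      (hY 1).aemeasurable (by fun_prop) (by fun_prop)]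
    exact congrArg _ ((hY_ident 1).sq.integral_eq)
  have hident (n : ℕ) : IdentDistrib (fun ω => X n ω * Y (n + 1) ω) (fun ω => X 0 ω * Y 1 ω)
      P P :=
    ((hX_ident n).prodMk ((hY_ident (n + 1)).trans (hY_ident 1).symm) (hsucc n)
      (hsucc 0)).comp (measurable_fst.mul measurable_snd)
  have hclt := tendstoInDistribution_inv_sqrt_mul_sum_sub (hvar ▸ hZ)
    (memLp_two_mul_of_indepFun (hsucc 0) hX_memLp ((hY_ident 1).memLp_iff.2 hY_memLp))
    (iIndepFun_mul_succ hX hY hpair hXY) hident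
  have hsqrt (n : ℕ) (S : ℝ) : √n * ((n : ℝ)⁻¹ * S) = (√n)⁻¹ * S := by
    rw [← mul_assoc, ← div_eq_mul_inv, Real.sqrt_div_self]
  simpa only [empMean_apply, hsqrt, hmean, zero_add, mul_zero, sub_zero] using hclt

end CentralLimit

namespace LendingPool

section CentralLimit

variable {m : Market} {K : Controller} {r₀ p₀ B₀ : ℝ}

lemma measurable_estimateError (hp : 0 < p₀) (n : ℕ) :
    Measurable fun ω => estimateError m r₀ p₀ B₀ ω n :=
  (((measurable_lsEstimator n).comp (measurable_snd.comp
    (measurable_trajectory measurable_lsEstimator hp n))).mono (slotFiltration.le n)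
    le_rfl).sub_const _

lemma measurable_explored (s : ℕ) : Measurable[slotFiltration s] fun ω => explored ω s := by
  cases s with
  | zero => exact measurable_const
  | succ s => exact measurable_explores.comp (measurable_slot s)

lemma indepFun_slotExploration_noise (m : Market) (K : Controller) (t : ℕ) :
    IndepFun (fun ω : ℕ → Slot => (ω t).2.2) (noise t) (poolLaw m K) :=
  indepFun_comp_measurePreserving (X := Prod.snd) (Y := Prod.fst)
    (indepFun_prod measurable_id measurable_id).symm measurable_snd measurable_fst
    (measurePreserving_snd.comp (measurePreserving_slot m K t))

lemma integral_noise_sq (m : Market) (K : Controller) (s : ℕ) :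
    ∫ ω, noise s ω ^ 2 ∂(poolLaw m K) = m.ζ ^ 2 :=
  ((hasLaw_noise m K s).integral_comp (by fun_prop)).trans (integral_sq_gaussianReal _)

variable (m K) in
lemma integral_affine_explores_sq (b c : ℝ) :
    ∫ x, (b * (explores x * (x.2.2.2 - m.equilibriumRate)) + c) ^ 2 ∂(slotLaw m K)
      = b ^ 2 * explorationMoment m K 2 + 2 * b * c * explorationMoment m K 1 + c ^ 2 := by
  have hexpand (x : Slot) : (b * (explores x * (x.2.2.2 - m.equilibriumRate)) + c) ^ 2
      = b ^ 2 * (explores x * (x.2.2.2 - m.equilibriumRate) ^ 2)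
        + 2 * b * c * (explores x * (x.2.2.2 - m.equilibriumRate) ^ 1) + c ^ 2 := by
    rcases explores_eq_zero_or_one x with h | h <;> rw [h] <;> ring
  have hint (k : ℕ) :
      Integrable (fun x => explores x * (x.2.2.2 - m.equilibriumRate) ^ k) (slotLaw m K) :=
    (memLp_explores_mul m K (g := fun w => (w - m.equilibriumRate) ^ k) (by fun_prop)
      1).integrable le_rfl
  have hsq := (hint 2).const_mul (b ^ 2)
  have hlin := (hint 1).const_mul (2 * b * c)
  simp only [hexpand]
  rw [integral_add (by exact hsq.add hlin) (integrable_const _), integral_add hsq hlin,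
    integral_const_mul, integral_const_mul, integral_explores_mul_pow, integral_explores_mul_pow]
  simp

variable (m K) in
lemma tendstoInDistribution_sqrt_mul_empMean_affine_explores (b c : ℝ) :
    TendstoInDistribution (fun (n : ℕ) ω => √n * empMean n fun s =>
        (b * (explores (ω s) * ((ω s).2.2.2 - m.equilibriumRate)) + c) * noise (s + 1) ω)
      atTop id (fun _ => poolLaw m K) (gaussianReal 0 ((b ^ 2 * explorationMoment m K 2
        + 2 * b * c * explorationMoment m K 1 + c ^ 2) * m.ζ ^ 2).toNNReal) := by
  let X (x : Slot) : ℝ := b * (explores x * (x.2.2.2 - m.equilibriumRate)) + c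
  have hX_memLp : MemLp X 2 (slotLaw m K) :=
    ((memLp_explores_mul m K (g := fun w => w - m.equilibriumRate) (by fun_prop) 2).const_mul
      b).add (memLp_const c)
  have hcoin : Measurable fun e : Bool => if e then (1 : ℝ) else 0 := by fun_prop
  have hcontrol : Measurable fun y : Bool × ℝ =>
      b * ((if y.1 then 1 else 0) * (y.2 - m.equilibriumRate)) + c :=
    (((hcoin.comp measurable_fst).mul (measurable_snd.sub_const _)).const_mul b).add_const c
  have hX : Measurable X := hcontrol.comp (measurable_snd.comp measurable_snd)
  have hnoise (s : ℕ) : Measurable (noise s) :=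
    (measurable_noise s).mono (slotFiltration.le _) le_rfl
  have hmp := measurePreserving_slot m K
  have hpair : iIndepFun (fun s ω => (X (ω s), noise s ω)) (poolLaw m K) :=
    (iIndepFun_slot m K).comp (fun _ x => (X x, x.2.1)) fun _ =>
      hX.prodMk (measurable_fst.comp measurable_snd)
  have hXnoise (s : ℕ) : IndepFun (fun ω : ℕ → Slot => X (ω s)) (noise s) (poolLaw m K) :=
    (indepFun_slotExploration_noise m K s).comp hcontrol measurable_id
  have hX_sq := ((hmp 0).hasLaw.integral_comp (hX.pow_const 2).aestronglyMeasurable).trans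
    (integral_affine_explores_sq m K b c)
  refine tendstoInDistribution_sqrt_mul_empMean_mul_succ
    (fun s => hX.comp (measurable_pi_apply s)) hnoise hpair hXnoise
    (fun s => ((hmp s).hasLaw.identDistrib (hmp 0).hasLaw).comp hX)
    (fun s => (hasLaw_noise m K s).identDistrib (hasLaw_noise m K 0))
    (hX_memLp.comp_measurePreserving (hmp 0)) (memLp_noise m K 0 2) (integral_noise m K 0) ?_
  simp only [Function.comp_apply] at hX_sq
  rw [hX_sq, integral_noise_sq]
  exact HasLaw.id

lemma tendstoInMeasure_sqrt_mul_empMean_exploited (hη : m.η ≠ 0) (hp : 0 < p₀) (hB : B₀ ≠ 0)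
    (b : ℝ) : TendstoInMeasure (poolLaw m K) (fun (n : ℕ) ω => √n * empMean n fun s =>
      b * (rateError m r₀ p₀ B₀ ω s - explored ω s * rateError m r₀ p₀ B₀ ω s) * noise s ω)
      atTop 0 := by
  have hH (s : ℕ) : Measurable[slotFiltration s] fun ω =>
      b * (rateError m r₀ p₀ B₀ ω s - explored ω s * rateError m r₀ p₀ B₀ ω s) :=
    ((measurable_rateError hp s).sub
      ((measurable_explored s).mul (measurable_rateError hp s))).const_mul b
  refine (isSubgaussianNoise m K).tendstoInMeasure_sqrt_mul_empMean hH
    (tendstoInMeasure_of_tendsto_ae (fun n => ?_) ?_)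
  · exact ((measurable_empMean n).comp (measurable_pi_lambda _ fun s =>
      ((hH s).mono (slotFiltration.le s) le_rfl).pow_const 2)).aestronglyMeasurable
  · filter_upwards [ae_adaptiveRegression (r₀ := r₀) K hη hp hB] with ω hω
    have := tendsto_empMean ((hω.tendsto_sub_explored.const_mul b).pow 2)
    rwa [mul_zero, zero_pow two_ne_zero] at this

lemma measurable_empMean_affine_rateError (hp : 0 < p₀) (b c : ℝ) (n : ℕ) : Measurable fun ω =>
    empMean n fun s => (b * rateError m r₀ p₀ B₀ ω s + c) * noise s ω :=
  (measurable_empMean n).comp (measurable_pi_lambda _ fun s =>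
    ((((measurable_rateError hp s).mono (slotFiltration.le s) le_rfl).const_mul b).add_const c).mul
      ((measurable_noise s).mono (slotFiltration.le _) le_rfl))

lemma tendstoInDistribution_sqrt_mul_empMean_affine_rateError (hη : m.η ≠ 0) (hp : 0 < p₀)
    (hB : B₀ ≠ 0) (b c : ℝ) :
    TendstoInDistribution (fun (n : ℕ) ω => √n * empMean n fun s =>
        (b * rateError m r₀ p₀ B₀ ω s + c) * noise s ω)
      atTop id (fun _ => poolLaw m K) (gaussianReal 0 ((b ^ 2 * explorationMoment m K 2
        + 2 * b * c * explorationMoment m K 1 + c ^ 2) * m.ζ ^ 2).toNNReal) := by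
  have hexplored : TendstoInDistribution (fun (n : ℕ) ω => √n * empMean n fun s =>
      (b * (explored ω s * rateError m r₀ p₀ B₀ ω s) + c) * noise s ω) atTop id
      (fun _ => poolLaw m K) (gaussianReal 0 ((b ^ 2 * explorationMoment m K 2
        + 2 * b * c * explorationMoment m K 1 + c ^ 2) * m.ζ ^ 2).toNNReal) := by
    refine tendstoInDistribution_sqrt_mul_empMean_of_succ
      (f := fun s ω => (b * (explored ω s * rateError m r₀ p₀ B₀ ω s) + c) * noise s ω)
      (fun s => ?_) ?_
    · exact (((((measurable_explored s).mul (measurable_rateError hp s)).mono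
        (slotFiltration.le s) le_rfl).const_mul b).add_const c).mul
        ((measurable_noise s).mono (slotFiltration.le _) le_rfl)
    · have hsucc (ω : ℕ → Slot) (s : ℕ) : explored ω (s + 1) * rateError m r₀ p₀ B₀ ω (s + 1)
          = explores (ω s) * ((ω s).2.2.2 - m.equilibriumRate) := by
        simpa only [pow_one, rateError] using
          explored_mul_rate_sub_pow lsEstimator_isLocal ω 1 s
      simpa only [hsucc] using
        tendstoInDistribution_sqrt_mul_empMean_affine_explores m K b c
  refine tendstoInDistribution_of_tendstoInMeasure_sub _ _ hexplored ?_ fun n =>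
    ((measurable_empMean_affine_rateError hp b c n).const_mul _).aemeasurable
  convert tendstoInMeasure_sqrt_mul_empMean_exploited (r₀ := r₀) hη hp hB b using 1
  ext n ω
  rw [Pi.sub_apply, Pi.sub_apply, ← mul_sub, ← map_sub]
  congr 2
  ext s
  simp only [Pi.sub_apply]
  ring

end CentralLimit

/-- The variance of the Gaussian limit of `√n * (r̂ₙ - r*)` under the least-squares estimator. It is
that of `(q - a * x) * ε / (η * (q - a ^ 2))`, where `ε` is the noise and `x`, with first moments
`a` and `q`, is the deviation of the rate from `r*` in a slot with exploration and `0` otherwise. -/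
def asymptoticVariance (m : Market) (K : Controller) : ℝ :=
  m.ζ ^ 2 * explorationMoment m K 2 /
    (m.η ^ 2 * (explorationMoment m K 2 - explorationMoment m K 1 ^ 2))

section AsymptoticNormality

variable {m : Market} {K : Controller} {r₀ p₀ B₀ : ℝ}

lemma asymptoticVariance_pos (hη : m.η ≠ 0) : 0 < asymptoticVariance m K :=
  div_pos (mul_pos (pow_pos (NNReal.coe_pos.2 m.ζ_pos) 2) (explorationMoment_two_pos m K))
    (mul_pos (by positivity) (sub_pos.2 (explorationMoment_one_sq_lt_two m K)))

variable (m r₀ p₀ B₀) in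
lemma measurable_rateError_path (hp : 0 < p₀) : Measurable (rateError m r₀ p₀ B₀) :=
  measurable_pi_lambda _ fun s => (measurable_rateError hp s).mono (slotFiltration.le s) le_rfl

lemma tendstoInMeasure_sub_mul_affine_rateError (hη : m.η ≠ 0) (hp : 0 < p₀) (hB : B₀ ≠ 0)
    {w : ℕ → (ℕ → Slot) → ℝ} {l : ℝ} (hw : ∀ n, Measurable (w n))
    (hlim : ∀ᵐ ω ∂(poolLaw m K), Tendsto (w · ω) atTop (𝓝 l)) (b c : ℝ) :
    TendstoInMeasure (poolLaw m K) (fun (n : ℕ) ω => (w n ω - l) *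
      (√n * empMean n fun s => (b * rateError m r₀ p₀ B₀ ω s + c) * noise s ω)) atTop 0 := by
  refine tendstoInMeasure_mul_zero
    (tendstoInDistribution_sqrt_mul_empMean_affine_rateError hη hp hB b c)
    (fun n => ((hw n).sub_const l).aemeasurable)
    (tendstoInMeasure_of_tendsto_ae (fun n => ((hw n).sub_const l).aestronglyMeasurable) ?_)
  filter_upwards [hlim] with ω hω
  simpa using hω.sub_const l

variable (m r₀ p₀ B₀) in
lemma measurable_lsDenominator (hp : 0 < p₀) (n : ℕ) : Measurable fun ω : ℕ → Slot =>
    empCov n (rateError m r₀ p₀ B₀ ω) (noise · ω)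
      - m.η * empCov n (rateError m r₀ p₀ B₀ ω) (rateError m r₀ p₀ B₀ ω) := by
  have hx := measurable_rateError_path m r₀ p₀ B₀ hp
  have hε : Measurable fun (ω : ℕ → Slot) s => noise s ω :=
    measurable_pi_lambda _ fun s => (measurable_noise s).mono (slotFiltration.le _) le_rfl
  exact ((measurable_empCov n).comp (hx.prodMk hε)).sub
    (((measurable_empCov n).comp (hx.prodMk hx)).const_mul m.η)

lemma tendstoInMeasure_sqrt_mul_estimateError_sub (hη : m.η ≠ 0) (hp : 0 < p₀) (hB : B₀ ≠ 0)
    {D : ℝ} (hD : D = -(m.η * (explorationMoment m K 2 - explorationMoment m K 1 ^ 2))) :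
    TendstoInMeasure (poolLaw m K) (fun (n : ℕ) ω => √n * estimateError m r₀ p₀ B₀ ω n
      - √n * empMean n fun s => (explorationMoment m K 1 / D * rateError m r₀ p₀ B₀ ω s
        + -explorationMoment m K 2 / D) * noise s ω) atTop 0 := by
  have hpath := ae_adaptiveRegression (r₀ := r₀) K hη hp hB
  have hx := measurable_rateError_path m r₀ p₀ B₀ hp
  have hDm := measurable_lsDenominator m r₀ p₀ B₀ hp
  have hAm (n : ℕ) := ((measurable_empMean n).comp hx).div (hDm n)
  have hQm (n : ℕ) := ((measurable_empMean n).comp (hx.pow_const 2)).neg.div (hDm n)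
  have hslope := tendstoInMeasure_sub_mul_affine_rateError (r₀ := r₀) hη hp hB hAm
    (hpath.mono fun ω h => h.tendsto_mean.div h.tendsto_denominator h.denominator_limit_ne_zero) 1 0
  have hintercept := tendstoInMeasure_sub_mul_affine_rateError (r₀ := r₀) hη hp hB hQm
    (hpath.mono fun ω h =>
      h.tendsto_mean_sq.neg.div h.tendsto_denominator h.denominator_limit_ne_zero) 0 1
  have hmeas (b c : ℝ) (n : ℕ) := (measurable_empMean_affine_rateError (m := m) (r₀ := r₀)
    (B₀ := B₀) hp b c n).const_mul √n
  have hterm {w : ℕ → (ℕ → Slot) → ℝ} (hw : ∀ n, Measurable (w n)) (l b c : ℝ) (n : ℕ) :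
      AEMeasurable (fun ω => (w n ω - l) * (√n * empMean n fun s =>
        (b * rateError m r₀ p₀ B₀ ω s + c) * noise s ω)) (poolLaw m K) :=
    (((hw n).sub_const l).mul (hmeas b c n)).aemeasurable
  refine tendstoInMeasure_zero_of_ae_eventually_eq
    (tendstoInMeasure_add_zero hslope hintercept (hterm hAm _ 1 0) (hterm hQm _ 0 1))
    (fun n => (hterm hAm _ 1 0 n).add (hterm hQm _ 0 1 n))
    (fun n => (((measurable_estimateError hp n).const_mul _).sub (hmeas _ _ n)).aemeasurable) ?_
  filter_upwards [hpath] with ω h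
  filter_upwards [h.estimate_eventuallyEq_moments] with n hn
  rw [hn, hD]
  simp only [Pi.add_apply, Function.comp_apply, Pi.div_apply, Pi.neg_apply, empMean_affine_mul]
  ring

theorem tendstoInDistribution_sqrt_mul_estimateError (hη : m.η ≠ 0) (hp : 0 < p₀)
    (hB : B₀ ≠ 0) :
    TendstoInDistribution (fun (n : ℕ) ω => √n * estimateError m r₀ p₀ B₀ ω n) atTop id
      (fun _ => poolLaw m K) (gaussianReal 0 (asymptoticVariance m K).toNNReal) := by
  have hvar := (sub_pos.2 (explorationMoment_one_sq_lt_two m K)).ne'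
  set D := -(m.η * (explorationMoment m K 2 - explorationMoment m K 1 ^ 2)) with hD
  have hlin := tendstoInDistribution_sqrt_mul_empMean_affine_rateError (K := K) (r₀ := r₀) hη hp hB
    (explorationMoment m K 1 / D) (-explorationMoment m K 2 / D)
  have h := tendstoInDistribution_of_tendstoInMeasure_sub _ _ hlin
    (tendstoInMeasure_sqrt_mul_estimateError_sub hη hp hB hD)
    fun n => ((measurable_estimateError hp n).const_mul _).aemeasurable
  convert h using 3
  rw [asymptoticVariance, hD]
  field_simp
  ring

end AsymptoticNormality

end LendingPool

section GaussianConcentration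

lemma sqrt_two_pi_mul_exp_two_le : √(2 * Real.pi) * Real.exp 2 ≤ 20 := by
  have hpi : √(2 * Real.pi) ≤ 2.51 := by
    rw [Real.sqrt_le_left (by norm_num)]
    linarith [Real.pi_lt_d2]
  have hexp : Real.exp 2 ≤ 7.4 := by
    calc Real.exp 2 = Real.exp 1 ^ 2 := by rw [← Real.exp_nat_mul]; norm_num
      _ ≤ 2.72 ^ 2 := by gcongr; linarith [Real.exp_one_lt_d9]
      _ ≤ 7.4 := by norm_num
  calc √(2 * Real.pi) * Real.exp 2 ≤ 2.51 * 7.4 := by gcongr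
    _ ≤ 20 := by norm_num

lemma div_le_gaussianReal_abs_lt {v : ℝ≥0} (hv : v ≠ 0) {t : ℝ} (ht : 0 ≤ t)
    (ht_le : t ≤ 2 * √v) : t / (10 * √v) ≤ (gaussianReal 0 v).real {x | |x| < t} := by
  have hv_pos : 0 < (v : ℝ) := NNReal.coe_pos.2 (pos_iff_ne_zero.2 hv)
  have hset : {x : ℝ | |x| < t} = Set.Ioo (-t) t := by
    ext x
    exact abs_lt (a := x) (b := t)
  have hpdf (x : ℝ) (hx : x ∈ Set.Ioo (-t) t) : (20 * √v)⁻¹ ≤ gaussianPDFReal 0 v x := by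
    have hx_sq : x ^ 2 ≤ 2 * (2 * v) := by
      calc x ^ 2 ≤ (2 * √v) ^ 2 := sq_le_sq' (by linarith [hx.1]) (hx.2.le.trans ht_le)
        _ = 2 * (2 * v) := by rw [mul_pow, Real.sq_sqrt hv_pos.le]; ring
    calc (20 * √v)⁻¹ ≤ (√(2 * Real.pi) * Real.exp 2 * √v)⁻¹ := by
          gcongr
          exact sqrt_two_pi_mul_exp_two_le
      _ = (√(2 * Real.pi * v))⁻¹ * Real.exp (-2) := by
          rw [Real.sqrt_mul (x := 2 * Real.pi) (by positivity), Real.exp_neg]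
          ring
      _ ≤ gaussianPDFReal 0 v x := by
          rw [gaussianPDFReal, sub_zero, neg_div]
          gcongr
          rwa [div_le_iff₀ (by positivity)]
  have hint := setIntegral_mono_on (μ := volume) (integrableOn_const (C := (20 * √v)⁻¹) (by simp))
    (integrable_gaussianPDFReal 0 v).integrableOn measurableSet_Ioo hpdf
  rw [hset, measureReal_def, gaussianReal_apply_eq_integral _ hv, ENNReal.toReal_ofReal
    (setIntegral_nonneg measurableSet_Ioo fun x _ => gaussianPDFReal_nonneg 0 v x)]
  refine le_trans (le_of_eq ?_) hint
  rw [setIntegral_const, Real.volume_real_Ioo_of_le (by linarith), smul_eq_mul]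
  field_simp
  ring

lemma one_sub_two_mul_exp_le_gaussianReal_abs_lt (v : ℝ≥0) {t : ℝ} (ht : 0 ≤ t) :
    1 - 2 * Real.exp (-t ^ 2 / (2 * v)) ≤ (gaussianReal 0 v).real {x | |x| < t} := by
  have hsub := hasSubgaussianMGF_id_gaussianReal v
  have hmeas : MeasurableSet {x : ℝ | |x| < t} := measurableSet_lt (by fun_prop) measurable_const
  have hcompl : (gaussianReal 0 v).real {x | |x| < t}ᶜ ≤ 2 * Real.exp (-t ^ 2 / (2 * v)) := by
    calc (gaussianReal 0 v).real {x | |x| < t}ᶜ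
        ≤ (gaussianReal 0 v).real ({x | t ≤ id x} ∪ {x | t ≤ (-id) x}) :=
          measureReal_mono fun x (hx : ¬ |x| < t) => le_abs.1 (not_lt.1 hx)
      _ ≤ _ := measureReal_union_le _ _
      _ ≤ 2 * Real.exp (-t ^ 2 / (2 * v)) := by
          rw [two_mul]
          exact add_le_add (hsub.measure_ge_le ht) (hsub.neg.measure_ge_le ht)
  rw [probReal_compl_eq_one_sub hmeas] at hcompl
  linarith

lemma one_sub_exp_lt_gaussianReal_abs_lt {v : ℝ≥0} (hv : v ≠ 0) {L : ℝ} (hL : 0 < L) :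
    1 - Real.exp (-L) < (gaussianReal 0 v).real {x | |x| < 10 * √v * L} := by
  have hv_pos : 0 < (v : ℝ) := NNReal.coe_pos.2 (pos_iff_ne_zero.2 hv)
  rcases le_or_gt L (1 / 5) with hle | hgt
  · calc 1 - Real.exp (-L) < L := by linarith [Real.add_one_lt_exp (neg_ne_zero.2 hL.ne')]
      _ = 10 * √v * L / (10 * √v) := by field_simp
      _ ≤ _ := div_le_gaussianReal_abs_lt hv (by positivity)
        (by nlinarith [mul_le_mul_of_nonneg_left hle (Real.sqrt_nonneg v)])
  · have hexponent : -(10 * √v * L) ^ 2 / (2 * v) = -(50 * L ^ 2) := by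
      rw [mul_pow, mul_pow, Real.sq_sqrt hv_pos.le]
      field_simp
      norm_num
    refine lt_of_lt_of_le ?_ (one_sub_two_mul_exp_le_gaussianReal_abs_lt v (by positivity))
    rw [hexponent]
    refine sub_lt_sub_left ?_ 1
    calc 2 * Real.exp (-(50 * L ^ 2)) < Real.exp 1 * Real.exp (-(50 * L ^ 2)) := by
          gcongr
          linarith [Real.exp_one_gt_d9]
      _ = Real.exp (1 - 50 * L ^ 2) := by rw [← Real.exp_add, sub_eq_add_neg]
      _ ≤ Real.exp (-L) := Real.exp_le_exp.2 (by nlinarith)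

end GaussianConcentration

namespace LendingPool

theorem lsEstimator_isConvergenceBound {m : Market} {K : Controller} {r₀ p₀ B₀ : ℝ} (hη : m.η ≠ 0)
    (hp : 0 < p₀) (hB : B₀ ≠ 0) : IsConvergenceBound m K lsEstimator r₀ p₀ B₀
      (fun δ τ => 10 * √(asymptoticVariance m K) * (Real.log (1 / δ) / √τ)) := by
  intro δ hδ hδ_lt
  have hlog : 0 < Real.log (1 / δ) := Real.log_pos (one_lt_one_div hδ hδ_lt)
  have hexp : Real.exp (-Real.log (1 / δ)) = δ := by
    rw [one_div, Real.log_inv, neg_neg, Real.exp_log hδ]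
  have hmass := one_sub_exp_lt_gaussianReal_abs_lt
    (Real.toNNReal_pos.2 (asymptoticVariance_pos (K := K) hη)).ne' hlog
  rw [hexp, Real.coe_toNNReal _ (asymptoticVariance_pos hη).le] at hmass
  obtain ⟨T, hT⟩ := eventually_atTop.1 <| eventually_lt_measureReal_preimage_of_isOpen
    (tendstoInDistribution_sqrt_mul_estimateError (r₀ := r₀) hη hp hB)
    (isOpen_lt continuous_abs continuous_const) (by rwa [Measure.map_id])
  refine ⟨T, fun τ hτ => (hT τ hτ.le).le.trans_eq (congrArg _ ?_)⟩
  have hτ_pos : 0 < √(τ : ℝ) := Real.sqrt_pos.2 (Nat.cast_pos.2 (Nat.zero_lt_of_lt hτ))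
  ext ω
  change |√τ * estimateError m r₀ p₀ B₀ ω τ| < _ ↔ |estimateError m r₀ p₀ B₀ ω τ| < _ * (_ / √τ)
  rw [abs_mul, abs_of_pos hτ_pos, ← mul_div_assoc, lt_div_iff₀' hτ_pos]

end LendingPool

end

theorem mainTheorem2_general (m : LendingPool.Market) (hη : m.η ≠ 0) (K : LendingPool.Controller) :
    (∃ C : ℝ, 0 < C ∧ ∀ r₀ p₀ B₀ : ℝ, 0 < p₀ → B₀ ≠ 0 →
      LendingPool.IsConvergenceBound m K LendingPool.lsEstimator r₀ p₀ B₀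
        (fun δ τ => C * (Real.log (1 / δ) / Real.sqrt τ))) ∧
    (∀ r₀ p₀ B₀ : ℝ, 0 < p₀ → B₀ ≠ 0 → ∀ τ : ℕ, 1 ≤ τ →
      MeasureTheory.Integrable
        (LendingPool.stoppedRate m (LendingPool.knownElasticityEstimator m.η) r₀ p₀ B₀ τ)
        (LendingPool.poolLaw m K) ∧
      ∫ ω, LendingPool.stoppedRate m (LendingPool.knownElasticityEstimator m.η) r₀ p₀ B₀ τ ω
        ∂(LendingPool.poolLaw m K) = m.equilibriumRate) := by
  refine ⟨⟨10 * √(LendingPool.asymptoticVariance m K), ?_, fun r₀ p₀ B₀ hp hB => ?_⟩,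
    fun r₀ p₀ B₀ hp hB τ hτ => ⟨?_, ?_⟩⟩
  · exact mul_pos (by norm_num) (Real.sqrt_pos.2 (LendingPool.asymptoticVariance_pos hη))
  · exact LendingPool.lsEstimator_isConvergenceBound hη hp hB
  · exact LendingPool.integrable_stoppedRate_knownElasticityEstimator K hη hp hB
      (Nat.one_le_iff_ne_zero.1 hτ)
  · exact LendingPool.integral_stoppedRate_knownElasticityEstimator K hη hp hB
      (Nat.one_le_iff_ne_zero.1 hτ)

theorem mainTheorem2 (m : LendingPool.Market) (hη : 0 < m.η) (K : LendingPool.Controller) :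
    (∃ C : ℝ, 0 < C ∧ ∀ r₀ p₀ B₀ : ℝ, 0 < p₀ → 0 < B₀ →
      LendingPool.IsConvergenceBound m K LendingPool.lsEstimator r₀ p₀ B₀
        (fun δ τ => C * (Real.log (1 / δ) / Real.sqrt τ))) ∧
    (∀ r₀ p₀ B₀ : ℝ, 0 < p₀ → 0 < B₀ → ∀ τ : ℕ, 1 ≤ τ →
      MeasureTheory.Integrable
        (LendingPool.stoppedRate m (LendingPool.knownElasticityEstimator m.η) r₀ p₀ B₀ τ)
        (LendingPool.poolLaw m K) ∧
      ∫ ω, LendingPool.stoppedRate m (LendingPool.knownElasticityEstimator m.η) r₀ p₀ B₀ τ ω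
        ∂(LendingPool.poolLaw m K) = m.equilibriumRate) := by
  obtain ⟨⟨C, hC, hbound⟩, hunbiased⟩ := mainTheorem2_general m hη.ne' K
  exact ⟨⟨C, hC, fun r₀ p₀ B₀ hp hB => hbound r₀ p₀ B₀ hp hB.ne'⟩,
    fun r₀ p₀ B₀ hp hB => hunbiased r₀ p₀ B₀ hp hB.ne'⟩
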